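/- **Setting.** Let $\Sigma$ be a finite alphabet and $\mathcal X$ a finite set of variables with a distinguished variable $O\in\mathcal X$. A (copyless) *substitution* is a map $\sigma:\mathcal X\to(\mathcal X\cup\Sigma)^*$ such that no variable occurs twice in one image $\sigma(X)$ and no variable occurs in two images $\sigma(X)$, $\sigma(Y)$ with $X\ne Y$. It is extended to a morphism of $(\mathcal X\cup\Sigma)^*$ that fixes every letter, and $\sigma\circ\tau$ applies $\tau$ first. The *size* of $\sigma$ is $\sum_{X}|\sigma(X)|$, and $\sigma_\varepsilon$ maps every variable to the empty word. For a sequence $\lambda=\sigma_1\cdots\sigma_n$ of substitutions: * $\mathrm{out}(\lambda)=(\sigma_\varepsilon\circ\sigma_1\circ\cdots\circ\sigma_n)(O)\in\Sigma^*$. The *origin* $\mathrm{orig}_\lambda(i)\in\{1,\dots,n\}$ of an output position $i$ is the index of the substitution that produces the $i$-th letter of $\mathrm{out}(\lambda)$. Formally, it is the $i$-th letter of the output of the sequence obtained by replacing every letter in $\sigma_t$ by the number $t$, for each $t$. * $\mathrm{weight}_{j,t}(\lambda)=|\{1\le i\le \min(j,|\mathrm{out}(\lambda)|) : \mathrm{orig}_\lambda(i)\le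 t\}|$. * For $0\le s<t\le n$, $\mathrm{pump}(\lambda,(s,t])=\sigma_1\cdots\sigma_t\,\sigma_{s+1}\cdots\sigma_n$. The *primitive root* of a word $u$ is the shortest $w$ with $u=w^m$ for some $m\ge1$. For $b>0$, the *$b$-factorization* of $u$ is obtained from left to right by repeatedly cutting off the longest prefix of the remaining word whose primitive root has length at most $b$. The set $\mathrm{cut}_b(u)$ consists of the end positions of these factors. If $|\lambda|=|\mu|$ and $\mathrm{out}(\lambda)=\mathrm{out}(\mu)$, then $$\mathrm{delay}_b(\lambda,\mu)=\max_{j\in \mathrm{cut}_b(\mathrm{out}(\lambda))}\ \max_{1\le t\le|\lambda|}\bigl|\mathrm{weight}_{j,t}(\lambda)-\mathrm{weight}_{j,t}(\mu)\bigr|,$$ where a maximum over the empty set is $0$. **Lemma.** There is an absolute constant $c$ such that the following holds for all $\Sigma$, $\mathcal X$, $O$ as above and every finite set $\mathcal S$ of substitutions. Let $M$ be the maximal size of an element of $\mathcal S$ (with $M=0$ if $\mathcal S=\emptyset$). There are integers $k\ge0$ and $\ell\ge1$, both at most $$(M+1)^{c}\,(|\mathcal X|+1)^{c(|\mathcal X|+1)}$$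 (so $2^{O(|\mathcal X|\log(|\mathcal X|+1))}$ for bounded $M$, i.e. exponential in the number of variables), with the following property. For every integer $C\ge0$ and all $\lambda,\mu\in\mathcal S^*$ with $|\lambda|=|\mu|$, $\mathrm{out}(\lambda)=\mathrm{out}(\mu)$ and, if $C\ge 1$, $\mathrm{delay}_{C\ell}(\lambda,\mu)>C^2k$, there are integers $0\le t_1<t_2<\dots<t_C<|\lambda|$ such that $$\mathrm{out}\bigl(\mathrm{pump}(\lambda,(t_i,t_j])\bigr)\ne \mathrm{out}\bigl(\mathrm{pump}(\mu,(t_i,t_j])\bigr)\qquad\text{for all }1\le i<j\le C .$$ For $C=0$ the conclusion is empty. -/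

import Mathlib

namespace SST

/-- The variables occurring in a word over variables `X` and letters `A`, in order of occurrence and
with multiplicity. -/
def vars {X A : Type*} (w : List (X ⊕ A)) : List X := w.filterMap Sum.getLeft?

/-- The letters occurring in a word over variables `X` and letters `A`.  This is the image of the
word under the substitution that sends every variable to the empty word. -/
def letters {X A : Type*} (w : List (X ⊕ A)) : List A := w.filterMap Sum.getRight?

/-- Copyless substitutions: no variable occurs twice in the image of a variable, and no variable
occurs in the images of two distinct variables. -/
structure Subst (X A : Type*) where
  image : X → List (X ⊕ A)
  nodup : ∀ x, (vars (image x)).Nodup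
  disjoint : ∀ x y, x ≠ y → (vars (image x)).Disjoint (vars (image y))

/-- The morphic extension of a substitution to words over variables and letters. -/
def Subst.apply {X A : Type*} (σ : Subst X A) (w : List (X ⊕ A)) : List (X ⊕ A) :=
  w.flatMap (Sum.elim σ.image (fun a => [Sum.inr a]))

/-- The size of a substitution: the total length of the images of the variables. -/
def Subst.size {X A : Type*} [Fintype X] (σ : Subst X A) : ℕ := ∑ x, (σ.image x).length

/-- The output of `σ₁ ⋯ σₙ`: the word `(σ_ε ∘ σ₁ ∘ ⋯ ∘ σₙ)(O)`, where `σ_ε` erases all variables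
and `σ ∘ τ` applies `τ` first. -/
def out {X A : Type*} (O : X) (l : List (Subst X A)) : List A :=
  letters (l.foldr Subst.apply [Sum.inl O])

theorem vars_map {X A B : Type*} (f : A → B) (w : List (X ⊕ A)) :
    vars (w.map (Sum.map id f)) = vars w := by
  induction w with
  | nil => rfl
  | cons s w ih => cases s <;> simp_all [vars, List.filterMap_cons]

/-- Replace every letter produced by the substitution by the number `t`. -/
def Subst.stamp {X A : Type*} (σ : Subst X A) (t : ℕ) : Subst X ℕ where
  image x := (σ.image x).map (Sum.map id (fun _ => t))
  nodup x := by rw [vars_map]; exact σ.nodup x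
  disjoint x y h := by rw [vars_map, vars_map]; exact σ.disjoint x y h

/-- The word of origins: its letter at position `i` is the index (from `1` to `n`) of the
substitution that produces the `i`-th letter of the output of `σ₁ ⋯ σₙ`. -/
def originWord {X A : Type*} (O : X) (l : List (Subst X A)) : List ℕ :=
  out O (l.mapIdx (fun i σ => σ.stamp (i + 1)))

/-- The number of positions `i ≤ j` of the output whose origin is at most `t`. -/
def weight {X A : Type*} (O : X) (j t : ℕ) (l : List (Subst X A)) : ℕ :=
  ((originWord O l).take j).countP (fun s => decide (s ≤ t))

/-- The weight difference at output position `j` and time `t`. -/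
def diff {X A : Type*} (O : X) (j t : ℕ) (l m : List (Subst X A)) : ℕ :=
  ((weight O j t l : ℤ) - (weight O j t m : ℤ)).natAbs

/-- The maximal weight difference at output position `j`, over the times `1, …, |l|`. -/
def maxDiff {X A : Type*} (O : X) (j : ℕ) (l m : List (Subst X A)) : ℕ :=
  (Finset.Icc 1 l.length).sup (fun t => diff O j t l m)

/-- The length of the primitive root of `u`, i.e. of the shortest word `w` such that `u = w ^ k` for
some positive `k`. -/
noncomputable def rootLength {A : Type*} (u : List A) : ℕ :=
  sInf {n | ∃ w : List A, w.length = n ∧ ∃ k : ℕ, 0 < k ∧ u = (List.replicate k w).flatten}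

/-- The length of the longest prefix of `u` whose primitive root has length at most `b`. -/
noncomputable def firstFactorLength {A : Type*} (b : ℕ) (u : List A) : ℕ :=
  Nat.findGreatest (fun n => rootLength (u.take n) ≤ b) u.length

/-- The `b`-factorization of a word, for `b > 0`: repeatedly cut off the longest prefix whose
primitive root has length at most `b`.  For `b > 0` the first factor of a nonempty word is nonempty,
so that `max 1` has no effect; it makes the recursion terminate for the irrelevant value `b = 0`. -/
noncomputable def factors {A : Type*} (b : ℕ) : List A → List (List A)
  | [] => []
  | a :: v =>
    (a :: v).take (max 1 (firstFactorLength b (a :: v))) ::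
      factors b ((a :: v).drop (max 1 (firstFactorLength b (a :: v))))
  termination_by u => u.length
  decreasing_by simp only [List.length_drop, List.length_cons]; omega

/-- The `b`-cuts of a word: the end positions of the factors of its `b`-factorization. -/
noncomputable def cuts {A : Type*} (b : ℕ) (u : List A) : Finset ℕ :=
  (Finset.Icc 1 (factors b u).length).image (fun i => ((factors b u).take i).flatten.length)

/-- The `b`-delay between two sequences of substitutions of the same length and with the same
output. -/
noncomputable def delay {X A : Type*} (O : X) (b : ℕ) (l m : List (Subst X A)) : ℕ :=
  (cuts b (out O l)).sup (fun j => maxDiff O j l m)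

/-- Pumping the substitutions at positions `s + 1, …, t` of `σ₁ ⋯ σₙ` (with `s < t ≤ n`): the
sequence `σ₁ ⋯ σₜ σₛ₊₁ ⋯ σₙ`. -/
def pump {S : Type*} (l : List S) (s t : ℕ) : List S := l.take t ++ l.drop s

end SST

namespace SST

/-! ### Periodic words and cuts -/

/-! Let `K` be the number of pairs of time types and put `b = C * K * (M + 1)`. The constants `k`
and `l` are chosen such that `C ^ 2 * k = 9 * b ^ 2` and `C * l = b`. A large delay then gives a cut
`j` and a time `T` at which, up to symmetry, λ has produced over `9 * b ^ 2` more of the first `j`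
letters than μ.

At time `s` the output is the word `future` with each variable replaced by its content `past`, and
pumping `(s, t]` plugs the contents of time `t` into the future of time `s` (`out_pump`). If `s` and
`t` have the same type, the pumped output therefore combines the blocks of future letters of time
`s` with the variable contents of time `t`. A factor of the output that starts at the position `a`
recorded in the type, and has no letter with origin in `(s, t]`, survives pumping and moves by the
growth of the weight at `a` (`exists_mix_drop`, `exists_drop_out_pump`). The total length grows by
the growth of the total weight (`length_out_pump`).

The weight difference of λ and μ starts at 0 and rises by at most `M` per step (`weight_succ_le`).
So pigeonhole (`exists_times`) finds `C` times with equal types for both sequences, at which the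
difference strictly increases, by at most `b` in total, while no letter of the window `[j - 2b, j +
b)` is produced between them. If pumping between two of these times gave equal outputs, the window
would occur there at two places at some distance `d` with `0 < d ≤ b`, hence would have period `d`.
A greedy factor cannot end inside such a window (`not_mem_cuts_of_period`), so `j` would not be a
cut. If `j` is within `b` of the end, there is no room for the window, and the lengths of the pumped
outputs already differ. -/

theorem rootLength_le {A : Type*} {u w : List A} {k : ℕ} (hk : 0 < k)
    (h : u = (List.replicate k w).flatten) : rootLength u ≤ w.length :=
  Nat.sInf_le ⟨w, rfl, k, hk, h⟩

theorem exists_root {A : Type*} (u : List A) :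
    ∃ w : List A, w.length = rootLength u ∧ ∃ k : ℕ, 0 < k ∧ u = (List.replicate k w).flatten :=
  Nat.sInf_mem (s := {n | ∃ w : List A, w.length = n ∧ ∃ k : ℕ, 0 < k ∧
    u = (List.replicate k w).flatten}) ⟨u.length, u, rfl, 1, one_pos, by simp⟩

/-- A word of length `k * |w|` with period `|w|` and prefix `w` is the power `w ^ k`. -/
theorem eq_flatten_replicate {A : Type*} (w : List A) : ∀ (k : ℕ) (u : List A),
    u.length = k * w.length → (∀ i, i < w.length → 0 < k → u[i]? = w[i]?) →
    (∀ i, i + w.length < u.length → u[i + w.length]? = u[i]?) →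
    u = (List.replicate k w).flatten
  | 0, u, hl, _, _ => by
    have : u = [] := List.length_eq_zero_iff.1 (by simpa using hl)
    simp [this]
  | k + 1, u, hl, hp, hper => by
    have hle : w.length ≤ u.length := by rw [hl]; nlinarith
    have htake : u.take w.length = w := by
      apply List.ext_getElem?
      intro i
      by_cases hi : i < w.length
      · rw [List.getElem?_take_of_lt hi, hp i hi (Nat.succ_pos k)]
      · rw [List.getElem?_eq_none (by simp; omega), List.getElem?_eq_none (by omega)]
    have hdl : (u.drop w.length).length = k * w.length := by
      rw [List.length_drop, hl, Nat.succ_mul]; omega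
    have ih := eq_flatten_replicate w k (u.drop w.length) hdl
      (fun i hi hk => by
        have hk' : 1 * w.length ≤ k * w.length := Nat.mul_le_mul_right _ hk
        rw [List.length_drop] at hdl
        rw [List.getElem?_drop, Nat.add_comm, hper i (by omega), hp i hi (Nat.succ_pos k)])
      (fun i hi => by
        rw [List.length_drop] at hi
        rw [List.getElem?_drop, List.getElem?_drop, ← Nat.add_assoc,
          hper (w.length + i) (by omega)])
    rw [List.replicate_succ, List.flatten_cons, ← ih]
    conv_lhs => rw [← List.take_append_drop w.length u, htake]

theorem period_mul {A : Type*} {v : List A} {d lo hi : ℕ}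
    (h : ∀ i, lo ≤ i → i + d < hi → v[i + d]? = v[i]?) (i : ℕ) (hlo : lo ≤ i) :
    ∀ c : ℕ, i + c * d < hi → v[i + c * d]? = v[i]?
  | 0, _ => by simp
  | c + 1, hc => by
    have e : i + (c + 1) * d = i + c * d + d := by ring
    rw [e] at hc ⊢
    rw [h _ (by omega) hc, period_mul h i hlo c (by omega)]

/-- The longest prefix whose primitive root has length at most `b` cannot end inside of a region
with a period `d ≤ b`. -/
theorem exists_longer_prefix {A : Type*} {b L d : ℕ} {v : List A} (hd : 0 < d) (hdb : d ≤ b)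
    (hL : L + b ≤ v.length) (hroot : rootLength (v.take L) ≤ b) (hL0 : 0 < L)
    (hper : ∀ i, L ≤ i + 2 * b → i + d < L + b → v[i + d]? = v[i]?) :
    ∃ n, L < n ∧ n ≤ v.length ∧ rootLength (v.take n) ≤ b := by
  -- If `L ≤ 2 * b`, the periodic region reaches back to the start of `v`, and the next multiple of
  -- `d` beyond `L` is the length of a power of `v.take d`. Otherwise the prefix is a power of `w`,
  -- and one more copy of `w` fits.
  by_cases hcase : L ≤ 2 * b
  · refine ⟨(L / d + 1) * d, ?_, ?_, ?_⟩
    · have := Nat.lt_div_mul_add (a := L) hd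
      rw [Nat.succ_mul]; omega
    · have := Nat.div_mul_le_self L d
      rw [Nat.succ_mul]; omega
    · have hn : (L / d + 1) * d ≤ L + b := by
        have := Nat.div_mul_le_self L d
        rw [Nat.succ_mul]; omega
      have hlen : (v.take d).length = d := by rw [List.length_take]; omega
      refine (rootLength_le (w := v.take d) (k := L / d + 1) (Nat.succ_pos _) ?_).trans
        (by rw [hlen]; exact hdb)
      apply eq_flatten_replicate
      · rw [hlen, List.length_take]; omega
      · intro i hi _
        rw [hlen] at hi
        have : d ≤ (L / d + 1) * d := Nat.le_mul_of_pos_left _ (Nat.succ_pos _)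
        rw [List.getElem?_take_of_lt hi, List.getElem?_take_of_lt (by omega)]
      · intro i hi
        rw [hlen] at hi ⊢
        rw [List.length_take] at hi
        rw [List.getElem?_take_of_lt (by omega), List.getElem?_take_of_lt (by omega)]
        exact hper i (by omega) (by omega)
  · push Not at hcase
    obtain ⟨w, hw, k, hk, hwk⟩ := exists_root (v.take L)
    have hwb : w.length ≤ b := hw ▸ hroot
    have hlen : L = k * w.length := by
      have := congrArg List.length hwk
      rw [List.length_take] at this
      simp at this
      omega
    have hwpos : 0 < w.length := by
      rcases Nat.eq_zero_or_pos w.length with h | h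
      · rw [h] at hlen; omega
      · exact h
    have hkw : w.length ≤ L := hlen ▸ Nat.le_mul_of_pos_left _ hk
    have hpre : ∀ i, i < w.length → v[i]? = w[i]? := by
      intro i hi
      have := congrArg (fun u : List A => u[i]?) hwk
      rw [List.getElem?_take_of_lt (by omega)] at this
      obtain ⟨k, rfl⟩ := Nat.exists_eq_succ_of_ne_zero hk.ne'
      rw [this, List.replicate_succ, List.flatten_cons, List.getElem?_append_left hi]
    have hw1 : ∀ i, i + w.length < L → v[i + w.length]? = v[i]? := by
      intro i hi
      obtain ⟨k, rfl⟩ := Nat.exists_eq_succ_of_ne_zero hk.ne'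
      have e1 := congrArg (fun u : List A => u[i + w.length]?) hwk
      have e2 := congrArg (fun u : List A => u[i]?) hwk
      rw [List.getElem?_take_of_lt (by omega)] at e1 e2
      rw [e1, e2]
      conv_lhs => rw [List.replicate_succ, List.flatten_cons,
        List.getElem?_append_right (by omega), Nat.add_sub_cancel]
      conv_rhs => rw [List.replicate_succ', List.flatten_append]
      rw [List.getElem?_append_left]
      rw [Nat.succ_mul] at hlen
      simp
      omega
    refine ⟨L + w.length, by omega, by omega, ?_⟩
    refine (rootLength_le (w := w) (k := k + 1) (Nat.succ_pos _) ?_).trans hwb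
    apply eq_flatten_replicate
    · rw [List.length_take, Nat.succ_mul, ← hlen]; omega
    · intro i hi _
      rw [List.getElem?_take_of_lt (by omega), hpre i hi]
    · intro i hi
      rw [List.length_take] at hi
      rw [List.getElem?_take_of_lt (by omega), List.getElem?_take_of_lt (by omega)]
      by_cases h1 : i + w.length < L
      · exact hw1 i h1
      -- `c * d` is the least multiple of `d` that moves position `i + w.length` to the left of `L`,
      -- where the period of `w` is known. Both positions stay at or above `L - w.length - d`, which
      -- is why the region extends `2 * b` to the left.
      · set c := (i + w.length - L) / d + 1 with hc
        have hc1 := Nat.lt_div_mul_add (a := i + w.length - L) hd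
        have hc2 := Nat.div_mul_le_self (i + w.length - L) d
        have hcd : c * d = (i + w.length - L) / d * d + d := Nat.succ_mul _ _
        obtain ⟨i', hi'⟩ : ∃ i', i = i' + c * d := ⟨i - c * d, by omega⟩
        have e1 := period_mul (lo := L - 2 * b) (hi := L + b)
          (fun i h1 h2 => hper i (by omega) h2) (i' + w.length) (by omega) c (by omega)
        have e2 := period_mul (lo := L - 2 * b) (hi := L + b)
          (fun i h1 h2 => hper i (by omega) h2) i' (by omega) c (by omega)
        have e3 := hw1 i' (by omega)
        rw [hi', show i' + c * d + w.length = i' + w.length + c * d by ring, e1, e2, e3]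

/-- All that is needed of the factorization: a cut is where some greedy factor ends, so maximality
of that factor can be contradicted without regard to the other factors. -/
theorem exists_factor_of_mem_cuts {A : Type*} {b : ℕ} : ∀ {u : List A} {j : ℕ}, j ∈ cuts b u →
    ∃ i, i < u.length ∧ j = i + max 1 (firstFactorLength b (u.drop i))
  | [], j, h => by simp [cuts, factors] at h
  | a :: v, j, h => by
    set L := max 1 (firstFactorLength b (a :: v)) with hL
    have hLe : L ≤ (a :: v).length :=
      max_le (by simp) (Nat.findGreatest_le _)
    simp only [cuts, Finset.mem_image, Finset.mem_Icc] at h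
    obtain ⟨i, ⟨hi1, hi2⟩, rfl⟩ := h
    rw [factors, ← hL] at hi2 ⊢
    obtain ⟨i, rfl⟩ := Nat.exists_eq_add_of_le' hi1
    rw [List.take_succ_cons, List.flatten_cons, List.length_append]
    have hlt : ((a :: v).take L).length = L := by rw [List.length_take]; omega
    rcases Nat.eq_zero_or_pos i with rfl | hi
    · exact ⟨0, by simp, by rw [hlt, List.drop_zero, ← hL]; simp⟩
    · have hmem : ((factors b ((a :: v).drop L)).take i).flatten.length ∈
          cuts b ((a :: v).drop L) := by
        simp only [cuts, Finset.mem_image, Finset.mem_Icc]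
        exact ⟨i, ⟨hi, by simpa using hi2⟩, rfl⟩
      obtain ⟨p, hp, hpe⟩ := exists_factor_of_mem_cuts hmem
      rw [List.length_drop] at hp
      refine ⟨L + p, by omega, ?_⟩
      rw [hpe, hlt, List.drop_drop]
      omega
  termination_by u => u.length
  decreasing_by simp only [List.length_drop, List.length_cons]; omega

/-- A cut does not lie in the interior of a long region with a small period. -/
theorem not_mem_cuts_of_period {A : Type*} {b j d : ℕ} {u : List A} (hd : 0 < d) (hdb : d ≤ b)
    (hj : j + b ≤ u.length)
    (hper : ∀ i, j ≤ i + 2 * b → i + d < j + b → u[i + d]? = u[i]?) : j ∉ cuts b u := by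
  intro h
  obtain ⟨i, hi, rfl⟩ := exists_factor_of_mem_cuts h
  set v := u.drop i with hv
  have hvl : v.length = u.length - i := List.length_drop
  -- The default `max 1` is harmless: a prefix of length at most 1 has a root of length at most `1 ≤
  -- d ≤ b`.
  have hroot : rootLength (v.take (max 1 (firstFactorLength b v))) ≤ b := by
    rcases Nat.eq_zero_or_pos (firstFactorLength b v) with h0 | h0
    · rw [h0]
      refine (rootLength_le (w := v.take 1) one_pos (by simp)).trans ?_
      rw [List.length_take]; omega
    · rw [max_eq_right h0]
      exact Nat.findGreatest_spec (P := fun n => rootLength (v.take n) ≤ b) (Nat.zero_le _)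
        ((rootLength_le (w := []) one_pos (by simp)).trans (Nat.zero_le _))
  obtain ⟨n, hn1, hn2, hn3⟩ := exists_longer_prefix (v := v) hd hdb (by omega) hroot
    (by omega) (fun p h1 h2 => by
      rw [hv, List.getElem?_drop, List.getElem?_drop, ← Nat.add_assoc]
      exact hper _ (by omega) (by omega))
  have := Nat.le_findGreatest (P := fun n => rootLength (v.take n) ≤ b) hn2 hn3
  change n ≤ firstFactorLength b v at this
  omega

/-! ### Choosing times -/

/-- A function that starts at `0`, grows by at most `m` per step and reaches a large value has a
long chain of times at which its values increase in a controlled way, and at which a given colouring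
and a given bounded monotone function are constant. -/
theorem exists_times {κ : Type*} [Fintype κ] (d : ℕ → ℤ) (T m U C : ℕ) (cl : ℕ → κ) (u : ℕ → ℕ)
    (h0 : d 0 ≤ 0) (hstep : ∀ s < T, d (s + 1) ≤ d s + m) (hu : Monotone u) (hU : ∀ s, u s ≤ U)
    (hT : (((U + 1) * (C * Fintype.card κ) * (m + 1) : ℕ) : ℤ) ≤ d T) :
    ∃ t : Fin C → ℕ, StrictMono t ∧ (∀ i, t i ≤ T) ∧ ∀ i j, i < j →
      d (t i) < d (t j) ∧ d (t j) - d (t i) ≤ ((C * Fintype.card κ * (m + 1) : ℕ) : ℤ) ∧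
      cl (t i) = cl (t j) ∧ u (t i) = u (t j) := by
  classical
  set W := C * Fintype.card κ with hW
  have hex : ∀ v : ℕ, v ≤ (U + 1) * W → ∃ s, s ≤ T ∧ ((v * (m + 1) : ℕ) : ℤ) ≤ d s := fun v hv =>
    ⟨T, le_rfl, le_trans (by exact_mod_cast Nat.mul_le_mul_right _ hv) hT⟩
  -- `S v` is the first time at which `d` reaches level `v * (m + 1)`. A step adds at most `m`, so
  -- `d` is still below the next level there; hence both `S` and `d ∘ S` are strictly increasing.
  have hS : ∀ v : ℕ, ∃ s, v ≤ (U + 1) * W → s ≤ T ∧ ((v * (m + 1) : ℕ) : ℤ) ≤ d s ∧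
      d s < (((v + 1) * (m + 1) : ℕ) : ℤ) ∧ ∀ r < s, d r < ((v * (m + 1) : ℕ) : ℤ) := by
    intro v
    by_cases hv : v ≤ (U + 1) * W
    · refine ⟨Nat.find (hex v hv), fun _ => ?_⟩
      obtain ⟨h1, h2⟩ := Nat.find_spec (hex v hv)
      have h3 : ∀ r < Nat.find (hex v hv), d r < ((v * (m + 1) : ℕ) : ℤ) := fun r hr => by
        have := Nat.find_min (hex v hv) hr
        push Not at this
        exact this (by omega)
      refine ⟨h1, h2, ?_, h3⟩
      rcases Nat.eq_zero_or_pos (Nat.find (hex v hv)) with hz | hz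
      · rw [hz]
        exact lt_of_le_of_lt h0 (by positivity)
      · have e : Nat.find (hex v hv) - 1 + 1 = Nat.find (hex v hv) := by omega
        have h4 := hstep (Nat.find (hex v hv) - 1) (by omega)
        have h5 := h3 (Nat.find (hex v hv) - 1) (by omega)
        rw [e] at h4
        push_cast at h5 ⊢
        linarith
    · exact ⟨0, fun h => absurd h hv⟩
  choose S hS using hS
  have hlt : ∀ v w, v < w → w ≤ (U + 1) * W → S v < S w ∧ d (S v) < d (S w) := by
    intro v w hvw hw
    obtain ⟨-, h2, h3, h4⟩ := hS v (by omega)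
    obtain ⟨-, g2, -, -⟩ := hS w hw
    have hm : (((v + 1) * (m + 1) : ℕ) : ℤ) ≤ ((w * (m + 1) : ℕ) : ℤ) := by
      exact_mod_cast Nat.mul_le_mul_right _ hvw
    have hdd : d (S v) < d (S w) := by linarith
    refine ⟨?_, hdd⟩
    rcases lt_trichotomy (S v) (S w) with h | h | h
    · exact h
    · rw [h] at hdd; exact absurd hdd (lt_irrefl _)
    · have := h4 _ h
      linarith
  -- The levels form `U + 1` blocks of `W`. If `u` grew across every block, it would exceed `U`.
  obtain ⟨q, hq, hqu⟩ : ∃ q, q ≤ U ∧ u (S (q * W)) = u (S ((q + 1) * W)) := by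
    by_contra hcon
    push Not at hcon
    have hmono : ∀ q, q ≤ U + 1 → q ≤ u (S (q * W)) := by
      intro q
      induction q with
      | zero => intro _; exact Nat.zero_le _
      | succ q ih =>
        intro hq
        have h1 := ih (by omega)
        have h2 := hcon q (by omega)
        have h3 : u (S (q * W)) ≤ u (S ((q + 1) * W)) := by
          apply hu
          rcases Nat.eq_zero_or_pos W with hz | hz
          · simp [hz]
          · exact (hlt _ _ (by rw [Nat.succ_mul]; omega) (Nat.mul_le_mul_right _ hq)).1.le
        omega
    have := hmono (U + 1) le_rfl
    have := hU (S ((U + 1) * W))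
    omega
  have hqW : (q + 1) * W ≤ (U + 1) * W := Nat.mul_le_mul_right _ (by omega)
  rw [Nat.succ_mul] at hqW
  rcases Nat.eq_zero_or_pos C with rfl | hC
  · exact ⟨fun i => i.elim0, fun i => i.elim0, fun i => i.elim0, fun i => i.elim0⟩
  have : Nonempty κ := ⟨cl 0⟩
  -- Inside the block where `u` is constant, `C * card κ` levels share `card κ` colours, so some
  -- colour occurs `C` times.
  obtain ⟨y, -, hy⟩ := Finset.exists_le_card_fiber_of_mul_le_card_of_maps_to
    (s := Finset.range W) (t := (Finset.univ : Finset κ)) (f := fun i => cl (S (q * W + i)))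
    (n := C) (fun _ _ => Finset.mem_univ _) Finset.univ_nonempty
    (by rw [Finset.card_range, Finset.card_univ, hW, Nat.mul_comm])
  set F := (Finset.range W).filter (fun i => cl (S (q * W + i)) = y) with hF
  set e := F.orderEmbOfCardLe hy with he
  have hmem : ∀ i, e i < W ∧ cl (S (q * W + e i)) = y := fun i => by
    have := Finset.orderEmbOfCardLe_mem F hy i
    rw [← he, hF, Finset.mem_filter, Finset.mem_range] at this
    exact this
  have huc : ∀ i < W, u (S (q * W + i)) = u (S (q * W)) := by
    intro i hi
    apply le_antisymm
    · rw [hqu, Nat.succ_mul]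
      exact hu (hlt _ _ (by omega) hqW).1.le
    · rcases Nat.eq_zero_or_pos i with rfl | hi0
      · simp
      · exact hu (hlt _ _ (by omega) (by omega)).1.le
  refine ⟨fun i => S (q * W + e i), ?_, ?_, ?_⟩
  · intro i j hij
    have h1 : e i < e j := e.strictMono hij
    have := (hmem j).1
    exact (hlt _ _ (by omega) (by omega)).1
  · intro i
    have := (hmem i).1
    exact (hS _ (by omega)).1
  · intro i j hij
    have h1 : e i < e j := e.strictMono hij
    have hi := hmem i
    have hj := hmem j
    refine ⟨(hlt _ _ (by omega) (by omega)).2, ?_, by rw [hi.2, hj.2],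
      by rw [huc _ hi.1, huc _ hj.1]⟩
    obtain ⟨-, h2, -, -⟩ := hS (q * W + e i) (by omega)
    obtain ⟨-, -, g3, -⟩ := hS (q * W + e j) (by omega)
    have h4 : (((q * W + e j + 1) * (m + 1) : ℕ) : ℤ) ≤
        (((q * W + e i) * (m + 1) + W * (m + 1) : ℕ) : ℤ) := by
      rw [← Nat.add_mul]
      exact_mod_cast Nat.mul_le_mul_right _ (by omega)
    rw [Nat.cast_add] at h4
    linarith

end SST

namespace SST

/-! ### Words that are divided into labelled cells -/

/-- The word of a list of labelled cells. -/
def flat {Y A : Type*} (r : List (Option Y × List A)) : List A := r.flatMap Prod.snd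

/-- The word of a list of labelled cells, with marks that tell which letters have a label. -/
def marked {Y A : Type*} (r : List (Option Y × List A)) : List (Bool × A) :=
  r.flatMap fun c => c.2.map (Prod.mk c.1.isSome)

/-- Take the unlabelled cells from the first list, and the labelled ones from the second. -/
def mix {Y A : Type*} (r r' : List (Option Y × List A)) : List A :=
  (List.zipWith (fun c c' => if c.1.isSome then c'.2 else c.2) r r').flatten

/-- The index of the cell that contains a given position. -/
def cellIdx {Y A : Type*} : List (Option Y × List A) → ℕ → ℕ
  | [], _ => 0
  | c :: r, p => if p < c.2.length then 0 else cellIdx r (p - c.2.length) + 1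

theorem cellIdx_le {Y A : Type*} (r : List (Option Y × List A)) (p : ℕ) :
    cellIdx r p ≤ r.length := by
  induction r generalizing p with
  | nil => simp [cellIdx]
  | cons c r ih =>
    rw [cellIdx, List.length_cons]
    split_ifs
    · omega
    · exact Nat.succ_le_succ (ih _)

theorem marked_map_snd {Y A : Type*} (r : List (Option Y × List A)) :
    (marked r).map Prod.snd = flat r := by
  simp [marked, flat, List.map_flatMap, Function.comp_def]

theorem length_marked {Y A : Type*} (r : List (Option Y × List A)) :
    (marked r).length = (flat r).length := by
  rw [← marked_map_snd, List.length_map]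

theorem map_mk_snd {A : Type*} (b : Bool) (l : List A) :
    (l.map (Prod.mk b)).map Prod.snd = l := by
  simp [Function.comp_def]

/-- Two words that begin with maximal blocks of the same colour: if the words agree up to a position
beyond one of these blocks, then the blocks are equal. -/
theorem strip_block {B : Type*} (f : B → Bool) (m : Bool) : ∀ (p q u v : List B) (n : ℕ),
    (∀ b ∈ p, f b = m) → (∀ b ∈ q, f b = m) → (∀ b ∈ u.head?, f b ≠ m) →
    (∀ b ∈ v.head?, f b ≠ m) → n ≤ (p ++ u).length → n ≤ (q ++ v).length →
    (p ++ u).take n = (q ++ v).take n →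
    (n ≤ p.length ∧ n ≤ q.length) ∨
      (p = q ∧ p.length ≤ n ∧ u.take (n - p.length) = v.take (n - p.length))
  | [], [], u, v, n, _, _, _, _, _, _, h => Or.inr ⟨rfl, Nat.zero_le _, by simpa using h⟩
  | [], b :: q, u, v, 0, _, _, _, _, _, _, _ => Or.inl ⟨by simp, by simp⟩
  | [], b :: q, [], v, n + 1, _, _, _, _, hn, _, _ => by simp at hn
  | [], b :: q, a :: u, v, n + 1, _, hq, hu, _, _, _, h => by
    simp only [List.nil_append, List.cons_append, List.take_succ_cons, List.cons.injEq] at h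
    exact absurd (h.1 ▸ hq b (by simp)) (hu a (by simp))
  | a :: p, [], u, v, 0, _, _, _, _, _, _, _ => Or.inl ⟨by simp, by simp⟩
  | a :: p, [], u, [], n + 1, _, _, _, _, _, hn, _ => by simp at hn
  | a :: p, [], u, b :: v, n + 1, hp, _, _, hv, _, _, h => by
    simp only [List.nil_append, List.cons_append, List.take_succ_cons, List.cons.injEq] at h
    exact absurd (h.1 ▸ hp a (by simp)) (hv b (by simp))
  | a :: p, b :: q, u, v, 0, _, _, _, _, _, _, _ => Or.inl ⟨by simp, by simp⟩
  | a :: p, b :: q, u, v, n + 1, hp, hq, hu, hv, h1, h2, h => by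
    simp only [List.cons_append, List.take_succ_cons, List.cons.injEq] at h
    rcases strip_block f m p q u v n (fun b hb => hp b (by simp [hb]))
      (fun b hb => hq b (by simp [hb])) hu hv (by simpa using h1) (by simpa using h2) h.2 with
      ⟨g1, g2⟩ | ⟨g1, g2, g3⟩
    · exact Or.inl ⟨by simpa using g1, by simpa using g2⟩
    · exact Or.inr ⟨by rw [h.1, g1], by simpa using g2, by simpa using g3⟩

/-- The first cell of the list, if there is one, has a label. -/
def HeadLabelled {Y A : Type*} (r : List (Option Y × List A)) : Prop :=
  ∀ c ∈ r.head?, c.1 ≠ none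

theorem marked_head {Y A : Type*} {r : List (Option Y × List A)} (hne : ∀ c ∈ r, c.2 ≠ [])
    (hr : HeadLabelled r) : ∀ b ∈ (marked r).head?, b.1 ≠ false := by
  rcases r with _ | ⟨⟨o, w⟩, r⟩
  · simp [marked]
  · intro b hb
    have h1 := hr (o, w) (by simp)
    have h2 := hne (o, w) (by simp)
    obtain ⟨a, w, rfl⟩ := List.exists_cons_of_ne_nil h2
    simp [marked] at hb
    rw [← hb]
    simpa [Option.isSome_iff_ne_none] using h1

theorem HeadLabelled.congr {Y A : Type*} {r r' : List (Option Y × List A)}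
    (h : List.Forall₂ (fun c c' => c.1 = c'.1) r r') (hr : HeadLabelled r) : HeadLabelled r' := by
  cases h with
  | nil => exact hr
  | cons h1 h2 =>
    intro c hc
    simp at hc
    rw [← hc, ← h1]
    exact hr _ (by simp)

/-- The remainders of an unlabelled cell are maximal blocks of unmarked letters, as the next cell is
labelled and nonempty. Equal marks thus force them to be equal unless the region ends within them,
so it does not matter that the mixed word takes this block from the first list. -/
theorem take_append_mix_of_unlabelled {Y A : Type*} {r r' : List (Option Y × List A)}
    (h : List.Forall₂ (fun c c' => c.1 = c'.1) r r')
    (hne : ∀ c ∈ r, c.2 ≠ []) (hne' : ∀ c ∈ r', c.2 ≠ []) (hr : HeadLabelled r)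
    (ih : ∀ n, n ≤ (flat r).length → n ≤ (flat r').length →
      (marked r).take n = (marked r').take n → (mix r r').take n = (flat r').take n)
    (α β : List A) (n : ℕ) (hn : n ≤ (α ++ flat r).length) (hn' : n ≤ (β ++ flat r').length)
    (heq : (α.map (Prod.mk false) ++ marked r).take n =
      (β.map (Prod.mk false) ++ marked r').take n) :
    (α ++ mix r r').take n = (β ++ flat r').take n := by
  have hflat : (α ++ flat r).take n = (β ++ flat r').take n := by
    have := congrArg (List.map Prod.snd) heq
    simpa only [List.map_take, List.map_append, marked_map_snd, map_mk_snd] using this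
  rcases strip_block Prod.fst false _ _ _ _ n (by simp) (by simp) (marked_head hne hr)
    (marked_head hne' (hr.congr h)) (by simpa [length_marked] using hn)
    (by simpa [length_marked] using hn') heq with ⟨g1, g2⟩ | ⟨g1, g2, g3⟩
  · rw [List.length_map] at g1 g2
    rw [List.take_append_of_le_length g1, List.take_append_of_le_length g2] at *
    exact hflat
  · have hαβ : α = β := by
      have := congrArg (List.map Prod.snd) g1
      simpa only [map_mk_snd] using this
    subst hαβ
    rw [List.length_map] at g2 g3
    rw [List.length_append] at hn hn'
    rw [List.take_append, List.take_append, ih _ (by omega) (by omega) g3]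

/-- Adjacent labelled cells may be bounded differently in the two lists, as marks do not show these
boundaries. The prefixes `α` and `β` collect such cells until an unlabelled cell ends the marked
block; the mixed word takes labelled cells from the second list, so only `β` appears in the
conclusion. -/
theorem take_append_mix {Y A : Type*} {r r' : List (Option Y × List A)}
    (h : List.Forall₂ (fun c c' => c.1 = c'.1) r r')
    (hne : ∀ c ∈ r, c.2 ≠ []) (hne' : ∀ c ∈ r', c.2 ≠ [])
    (hch : r.IsChain (fun c c' => c.1 = none → c'.1 ≠ none)) :
    ∀ (α β : List A) (n : ℕ), n ≤ (α ++ flat r).length → n ≤ (β ++ flat r').length →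
    (α.map (Prod.mk true) ++ marked r).take n = (β.map (Prod.mk true) ++ marked r').take n →
    (β ++ mix r r').take n = (β ++ flat r').take n := by
  induction h with
  | nil => intro α β n _ _ _; simp [mix, flat]
  | @cons c c' r r' hc h ih =>
    obtain ⟨o, w⟩ := c
    obtain ⟨o', w'⟩ := c'
    have hc' : o' = o := hc.symm
    subst hc'
    have hhead : o' = none → HeadLabelled r := by
      rintro rfl c hc
      rcases r with _ | ⟨c1, r⟩
      · simp at hc
      · simp at hc
        subst hc
        exact (List.isChain_cons_cons.1 hch).1 rfl
    have ih' := ih (fun c hc => hne c (by simp [hc])) (fun c hc => hne' c (by simp [hc]))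
      hch.tail
    intro α β n hn hn' heq
    rcases o' with _ | x
    · have hm : ∀ (w : List A) (r : List (Option Y × List A)),
          marked ((none, w) :: r) = w.map (Prod.mk false) ++ marked r := fun w r => rfl
      have hf : ∀ (w : List A) (r : List (Option Y × List A)),
          flat ((none, w) :: r) = w ++ flat r := fun w r => rfl
      have hx : mix ((none, w) :: r) ((none, w') :: r') = w ++ mix r r' := rfl
      rw [hm, hm] at heq
      rw [hf] at hn hn'
      rw [hf, hx]
      have hw := hne (none, w) (by simp)
      have hw' := hne' (none, w') (by simp)
      have hd : ∀ (w : List A) (r : List (Bool × A)), w ≠ [] →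
          ∀ b ∈ (w.map (Prod.mk false) ++ r).head?, b.1 ≠ true := by
        intro w r hw b hb
        obtain ⟨a, w, rfl⟩ := List.exists_cons_of_ne_nil hw
        simp at hb
        simp [← hb]
      rcases strip_block Prod.fst true _ _ _ _ n (by simp) (by simp) (hd w _ hw) (hd w' _ hw')
        (by simpa [length_marked] using hn)
        (by simpa [length_marked] using hn') heq with ⟨g1, g2⟩ | ⟨g1, g2, g3⟩
      · rw [List.length_map] at g2
        rw [List.take_append_of_le_length g2, List.take_append_of_le_length g2]
      · have hαβ : α = β := by
          have := congrArg (List.map Prod.snd) g1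
          simpa only [map_mk_snd] using this
        subst hαβ
        rw [List.length_map] at g2 g3
        rw [List.length_append] at hn hn'
        rw [List.take_append, List.take_append (l₁ := α)]
        congr 1
        exact take_append_mix_of_unlabelled h (fun c hc => hne c (by simp [hc]))
          (fun c hc => hne' c (by simp [hc])) (hhead rfl)
          (fun k h1 h2 h3 => ih' [] [] k h1 h2 h3) w w' _ (by omega) (by omega) g3
    · have hm : ∀ (w : List A) (r : List (Option Y × List A)),
          marked ((some x, w) :: r) = w.map (Prod.mk true) ++ marked r := fun w r => rfl
      have hf : ∀ (w : List A) (r : List (Option Y × List A)),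
          flat ((some x, w) :: r) = w ++ flat r := fun w r => rfl
      have hx : mix ((some x, w) :: r) ((some x, w') :: r') = w' ++ mix r r' := rfl
      rw [hm, hm] at heq
      rw [hf] at hn hn'
      rw [hf, hx, ← List.append_assoc, ← List.append_assoc]
      apply ih' (α ++ w) (β ++ w') n (by simpa using hn) (by simpa using hn')
      simpa using heq

/-- If two divisions of words into cells have the same labels, and the words and their marks agree
on a region that starts in cells with the same index, then the mixed word contains that region, too,
and its position is determined by the numbers of labelled letters on the left. -/
theorem exists_mix_drop {Y A : Type*} {r r' : List (Option Y × List A)}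
    (h : List.Forall₂ (fun c c' => c.1 = c'.1) r r')
    (hne : ∀ c ∈ r, c.2 ≠ []) (hne' : ∀ c ∈ r', c.2 ≠ [])
    (hch : r.IsChain (fun c c' => c.1 = none → c'.1 ≠ none)) :
    ∀ p q n : ℕ, 0 < n → cellIdx r p = cellIdx r' q → p + n ≤ (flat r).length →
    q + n ≤ (flat r').length →
    ((marked r).drop p).take n = ((marked r').drop q).take n →
    ∃ z, ((mix r r').drop z).take n = ((flat r').drop q).take n ∧
      z + ((marked r).take p).countP Prod.fst = p + ((marked r').take q).countP Prod.fst := by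
  induction h with
  | nil => intro p q n h0 _ hp; simp [flat] at hp; omega
  | @cons c c' r r' hc h ih =>
    obtain ⟨o, w⟩ := c
    obtain ⟨o', w'⟩ := c'
    have hc' : o' = o := hc.symm
    subst hc'
    have hhead : o' = none → HeadLabelled r := by
      rintro rfl c hc
      rcases r with _ | ⟨c1, r⟩
      · simp at hc
      · simp at hc
        subst hc
        exact (List.isChain_cons_cons.1 hch).1 rfl
    have hner : ∀ c ∈ r, c.2 ≠ [] := fun c hc => hne c (by simp [hc])
    have hner' : ∀ c ∈ r', c.2 ≠ [] := fun c hc => hne' c (by simp [hc])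
    have hm : ∀ (w : List A) (r : List (Option Y × List A)),
        marked ((o', w) :: r) = w.map (Prod.mk o'.isSome) ++ marked r := fun w r => rfl
    have hf : ∀ (w : List A) (r : List (Option Y × List A)),
        flat ((o', w) :: r) = w ++ flat r := fun w r => rfl
    have hx : mix ((o', w) :: r) ((o', w') :: r') =
        (if o'.isSome then w' else w) ++ mix r r' := rfl
    intro p q n h0 hidx hp hq heq
    simp only [cellIdx] at hidx
    rw [hm, hm] at heq ⊢
    rw [hf] at hp hq
    rw [hf, hx]
    rw [List.length_append] at hp hq
    -- Equal cell indices put both positions in the first cell or both beyond it. In the first cell,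
    -- the witness is the offset in the list from which the mixed word takes that cell: `p` if
    -- unlabelled, `q` if labelled.
    by_cases hpw : p < w.length
    · have hqw : q < w'.length := by
        by_contra hcon
        rw [if_pos hpw, if_neg hcon] at hidx
        omega
      rw [List.drop_append_of_le_length (by simpa using hpw.le),
        List.drop_append_of_le_length (by simpa using hqw.le), ← List.map_drop,
        ← List.map_drop] at heq
      rw [List.take_append_of_le_length (by simpa using hpw.le),
        List.take_append_of_le_length (by simpa using hqw.le), ← List.map_take, ← List.map_take,
        List.drop_append_of_le_length hqw.le]
      rcases o' with _ | x
      · refine ⟨p, ?_, ?_⟩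
        · simp only [Option.isSome_none, Bool.false_eq_true, if_false] at heq ⊢
          rw [List.drop_append_of_le_length hpw.le]
          exact take_append_mix_of_unlabelled h hner hner' (hhead rfl)
            (fun k h1 h2 h3 => take_append_mix h hner hner' hch.tail [] [] k h1 h2 h3)
            _ _ n (by rw [List.length_append, List.length_drop]; omega)
            (by rw [List.length_append, List.length_drop]; omega) heq
        · have hz : ∀ l : List A, (l.map (Prod.mk false)).countP Prod.fst = 0 := fun l => by
            simp [List.countP_eq_zero]
          simp only [Option.isSome_none, hz]
      · refine ⟨q, ?_, ?_⟩
        · simp only [Option.isSome_some, if_true] at heq ⊢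
          rw [List.drop_append_of_le_length hqw.le]
          exact take_append_mix h hner hner' hch.tail _ _ n
            (by rw [List.length_append, List.length_drop]; omega)
            (by rw [List.length_append, List.length_drop]; omega) heq
        · have hz : ∀ l : List A, (l.map (Prod.mk true)).countP Prod.fst = l.length := fun l => by
            rw [List.countP_eq_length.2 (by simp), List.length_map]
          simp only [Option.isSome_some, hz, List.length_take]
          omega
    · have hqw : ¬ q < w'.length := by
        intro hcon
        rw [if_neg hpw, if_pos hcon] at hidx
        omega
      rw [if_neg hpw, if_neg hqw] at hidx
      push Not at hpw hqw
      obtain ⟨p, rfl⟩ := Nat.exists_eq_add_of_le hpw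
      obtain ⟨q, rfl⟩ := Nat.exists_eq_add_of_le hqw
      have hdr : ∀ (b : Bool) (w : List A) (u : List (Bool × A)) (p : ℕ),
          (w.map (Prod.mk b) ++ u).drop (w.length + p) = u.drop p := fun b w u p => by
        rw [← List.length_map (f := Prod.mk b) (as := w), List.drop_append]
        simp
      have htk : ∀ (b : Bool) (w : List A) (u : List (Bool × A)) (p : ℕ),
          (w.map (Prod.mk b) ++ u).take (w.length + p) = w.map (Prod.mk b) ++ u.take p :=
        fun b w u p => by
          rw [← List.length_map (f := Prod.mk b) (as := w), List.take_append]
          simp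
      rw [hdr, hdr] at heq
      obtain ⟨z, hz1, hz2⟩ := ih hner hner' hch.tail p q n h0 (by simpa using hidx)
        (by omega) (by omega) heq
      refine ⟨(if o'.isSome then w' else w).length + z, ?_, ?_⟩
      · rw [← List.drop_drop, ← List.drop_drop, List.drop_left, List.drop_left]
        exact hz1
      · rw [htk, htk, List.countP_append, List.countP_append]
        rcases o' with _ | x
        · have hz : ∀ l : List A, (l.map (Prod.mk false)).countP Prod.fst = 0 := fun l => by
            simp [List.countP_eq_zero]
          simp only [Option.isSome_none, hz, Bool.false_eq_true, if_false]
          omega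
        · have hz : ∀ l : List A, (l.map (Prod.mk true)).countP Prod.fst = l.length := fun l => by
            rw [List.countP_eq_length.2 (by simp), List.length_map]
          simp only [Option.isSome_some, hz, if_true]
          omega

end SST

namespace SST

/-! ### Words over variables and letters -/

section Words

variable {X A B : Type*}

theorem vars_cons_inl (x : X) (w : List (X ⊕ A)) : vars (Sum.inl x :: w) = x :: vars w := rfl

theorem vars_cons_inr (a : A) (w : List (X ⊕ A)) : vars (Sum.inr a :: w) = vars w := rfl

theorem letters_cons_inl (x : X) (w : List (X ⊕ A)) : letters (Sum.inl x :: w) = letters w := rfl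

theorem letters_cons_inr (a : A) (w : List (X ⊕ A)) :
    letters (Sum.inr a :: w) = a :: letters w := rfl

theorem letters_append (u v : List (X ⊕ A)) : letters (u ++ v) = letters u ++ letters v :=
  List.filterMap_append

theorem vars_append (u v : List (X ⊕ A)) : vars (u ++ v) = vars u ++ vars v :=
  List.filterMap_append

theorem letters_map (f : A → B) (w : List (X ⊕ A)) :
    letters (w.map (Sum.map id f)) = (letters w).map f := by
  induction w with
  | nil => rfl
  | cons c w ih =>
    rcases c with x | a
    · exact ih
    · exact congrArg (f a :: ·) ih

/-- Replace every variable of a word by a word of letters. -/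
def plug (P : X → List A) (w : List (X ⊕ A)) : List A := w.flatMap (Sum.elim P fun a => [a])

theorem plug_cons_inl (P : X → List A) (x : X) (w : List (X ⊕ A)) :
    plug P (Sum.inl x :: w) = P x ++ plug P w := rfl

theorem plug_cons_inr (P : X → List A) (a : A) (w : List (X ⊕ A)) :
    plug P (Sum.inr a :: w) = a :: plug P w := rfl

theorem length_plug (P : X → List A) (w : List (X ⊕ A)) :
    (plug P w).length = (letters w).length + ((vars w).map fun x => (P x).length).sum := by
  induction w with
  | nil => rfl
  | cons c w ih =>
    rcases c with x | a
    · rw [plug_cons_inl, List.length_append, ih, letters_cons_inl, vars_cons_inl, List.map_cons,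
        List.sum_cons]
      omega
    · rw [plug_cons_inr, List.length_cons, ih, letters_cons_inr, vars_cons_inr, List.length_cons]
      omega

theorem countP_plug (P : X → List A) (q : A → Bool) (w : List (X ⊕ A)) :
    (plug P w).countP q = (letters w).countP q + ((vars w).map fun x => (P x).countP q).sum := by
  induction w with
  | nil => rfl
  | cons c w ih =>
    rcases c with x | a
    · rw [plug_cons_inl, List.countP_append, ih, letters_cons_inl, vars_cons_inl, List.map_cons,
        List.sum_cons]
      omega
    · rw [plug_cons_inr, List.countP_cons, ih, letters_cons_inr, vars_cons_inr, List.countP_cons]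
      omega

/-- The division of the word `plug P w` into cells: the nonempty images of variables, labelled by
these variables, and the maximal blocks of letters of `w` between them, without label. -/
def runs (P : X → List A) : List (X ⊕ A) → List (Option X × List A)
  | [] => []
  | Sum.inl x :: w => if (P x).isEmpty then runs P w else (some x, P x) :: runs P w
  | Sum.inr a :: w =>
    match runs P w with
    | (none, u) :: r => (none, a :: u) :: r
    | r => (none, [a]) :: r

theorem runs_cons_inl_of_empty {P : X → List A} {x : X} (h : P x = []) (w : List (X ⊕ A)) :
    runs P (Sum.inl x :: w) = runs P w := by
  rw [runs, h]; rfl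

theorem runs_cons_inl {P : X → List A} {x : X} (h : P x ≠ []) (w : List (X ⊕ A)) :
    runs P (Sum.inl x :: w) = (some x, P x) :: runs P w := by
  rw [runs, if_neg (by simpa using h)]

theorem runs_cons_inr_cases (P : X → List A) (a : A) (w : List (X ⊕ A)) :
    (∃ u r, runs P w = (none, u) :: r ∧ runs P (Sum.inr a :: w) = (none, a :: u) :: r) ∨
      (HeadLabelled (runs P w) ∧ runs P (Sum.inr a :: w) = (none, [a]) :: runs P w) := by
  rw [runs]
  rcases h : runs P w with _ | ⟨⟨_ | x, u⟩, r⟩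
  · exact Or.inr ⟨by simp [HeadLabelled], rfl⟩
  · exact Or.inl ⟨u, r, rfl, rfl⟩
  · exact Or.inr ⟨by simp [HeadLabelled], rfl⟩

theorem runs_ne_nil (P : X → List A) (w : List (X ⊕ A)) : ∀ c ∈ runs P w, c.2 ≠ [] := by
  induction w with
  | nil => simp [runs]
  | cons c w ih =>
    rcases c with x | a
    · by_cases h : P x = []
      · rwa [runs_cons_inl_of_empty h]
      · rw [runs_cons_inl h]
        simpa [h] using ih
    · rcases runs_cons_inr_cases P a w with ⟨u, r, h1, h2⟩ | ⟨-, h2⟩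
      · rw [h2]
        rw [h1] at ih
        simp only [List.mem_cons, forall_eq_or_imp] at ih ⊢
        exact ⟨by simp, ih.2⟩
      · rw [h2]
        simpa using ih

/-- Skipping empty variables lets the letter blocks around them merge, so unlabelled cells are
maximal; the comparison of marks relies on this. -/
theorem runs_isChain (P : X → List A) (w : List (X ⊕ A)) :
    (runs P w).IsChain fun c c' => c.1 = none → c'.1 ≠ none := by
  induction w with
  | nil => simp [runs]
  | cons c w ih =>
    rcases c with x | a
    · by_cases h : P x = []
      · rwa [runs_cons_inl_of_empty h]
      · rw [runs_cons_inl h, List.isChain_cons]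
        exact ⟨by simp, ih⟩
    · rcases runs_cons_inr_cases P a w with ⟨u, r, h1, h2⟩ | ⟨h1, h2⟩
      · rw [h2]
        rw [h1, List.isChain_cons] at ih
        rw [List.isChain_cons]
        exact ih
      · rw [h2, List.isChain_cons]
        exact ⟨fun c hc _ => h1 c hc, ih⟩

theorem mem_runs_some {P : X → List A} {w : List (X ⊕ A)} {x : X} {u : List A}
    (h : (some x, u) ∈ runs P w) : x ∈ vars w ∧ u = P x := by
  induction w with
  | nil => simp [runs] at h
  | cons c w ih =>
    rcases c with y | a
    · rw [vars_cons_inl]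
      by_cases hy : P y = []
      · rw [runs_cons_inl_of_empty hy] at h
        exact ⟨by simp [(ih h).1], (ih h).2⟩
      · rw [runs_cons_inl hy, List.mem_cons] at h
        rcases h with h | h
        · simp only [Prod.mk.injEq, Option.some.injEq] at h
          obtain ⟨rfl, rfl⟩ := h
          simp
        · exact ⟨by simp [(ih h).1], (ih h).2⟩
    · rw [vars_cons_inr]
      rcases runs_cons_inr_cases P a w with ⟨u', r, h1, h2⟩ | ⟨-, h2⟩
      · rw [h2] at h
        rw [h1] at ih
        exact ih (by simpa using h)
      · rw [h2] at h
        exact ih (by simpa using h)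

theorem some_mem_runs {P : X → List A} {w : List (X ⊕ A)} {x : X} (hx : x ∈ vars w)
    (h : P x ≠ []) : (some x, P x) ∈ runs P w := by
  induction w with
  | nil => simp [vars] at hx
  | cons c w ih =>
    rcases c with y | a
    · rw [vars_cons_inl, List.mem_cons] at hx
      by_cases hy : P y = []
      · rw [runs_cons_inl_of_empty hy]
        rcases hx with rfl | hx
        · exact absurd hy h
        · exact ih hx
      · rw [runs_cons_inl hy, List.mem_cons]
        rcases hx with rfl | hx
        · exact Or.inl rfl
        · exact Or.inr (ih hx)
    · have hm := ih hx
      rcases runs_cons_inr_cases P a w with ⟨u', r, h1, h2⟩ | ⟨-, h2⟩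
      · rw [h1] at hm
        rw [h2]
        simpa using hm
      · rw [h2]
        simp [hm]

theorem mem_letters_of_mem_runs {P : X → List A} {w : List (X ⊕ A)} {u : List A}
    (h : (none, u) ∈ runs P w) : ∀ a ∈ u, a ∈ letters w := by
  induction w generalizing u with
  | nil => simp [runs] at h
  | cons c w ih =>
    rcases c with y | b
    · rw [letters_cons_inl]
      by_cases hy : P y = []
      · rw [runs_cons_inl_of_empty hy] at h
        exact ih h
      · rw [runs_cons_inl hy] at h
        exact ih (by simpa using h)
    · rw [letters_cons_inr]
      intro a ha
      rcases runs_cons_inr_cases P b w with ⟨u', r, h1, h2⟩ | ⟨-, h2⟩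
      · rw [h2, List.mem_cons] at h
        rw [h1] at ih
        rcases h with h | h
        · simp only [Prod.mk.injEq, true_and] at h
          subst h
          rcases List.mem_cons.1 ha with rfl | ha
          · simp
          · exact List.mem_cons_of_mem _ (ih (by simp) a ha)
        · exact List.mem_cons_of_mem _ (ih (List.mem_cons_of_mem _ h) a ha)
      · rw [h2, List.mem_cons] at h
        rcases h with h | h
        · simp only [Prod.mk.injEq, true_and] at h
          subst h
          exact List.mem_cons.2 (Or.inl (by simpa using ha))
        · exact List.mem_cons_of_mem _ (ih h a ha)

/-- The cells of `plug P w` describe `plug Q w` for every `Q` that is empty where `P` is. -/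
theorem flatMap_runs {P Q : X → List A} {w : List (X ⊕ A)}
    (h : ∀ x ∈ vars w, P x = [] → Q x = []) :
    ((runs P w).flatMap fun c => c.1.elim c.2 Q) = plug Q w := by
  induction w with
  | nil => rfl
  | cons c w ih =>
    rcases c with x | a
    · have ih' := ih fun y hy => h y (by rw [vars_cons_inl]; simp [hy])
      rw [plug_cons_inl]
      by_cases hx : P x = []
      · rw [runs_cons_inl_of_empty hx, ih', h x (by rw [vars_cons_inl]; simp) hx, List.nil_append]
      · rw [runs_cons_inl hx, List.flatMap_cons, ih']
        rfl
    · have ih' := ih h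
      rw [plug_cons_inr]
      rcases runs_cons_inr_cases P a w with ⟨u, r, h1, h2⟩ | ⟨-, h2⟩
      · rw [h2, ← ih', h1]
        rfl
      · rw [h2, ← ih']
        rfl

theorem flat_runs (P : X → List A) (w : List (X ⊕ A)) : flat (runs P w) = plug P w := by
  rw [← flatMap_runs (P := P) (fun _ _ h => h), flat]
  apply List.flatMap_congr
  rintro ⟨_ | x, u⟩ hc
  · rfl
  · exact (mem_runs_some hc).2

/-- At most one unlabelled cell fits before, between and after the labelled ones. The second part is
what makes the induction work when a letter opens a new block. -/
theorem length_runs_le (P : X → List A) (w : List (X ⊕ A)) :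
    (runs P w).length ≤ 2 * (vars w).length + 1 ∧
      (HeadLabelled (runs P w) → (runs P w).length ≤ 2 * (vars w).length) := by
  induction w with
  | nil => simp [runs]
  | cons c w ih =>
    rcases c with x | a
    · rw [vars_cons_inl, List.length_cons]
      by_cases h : P x = []
      · rw [runs_cons_inl_of_empty h]
        exact ⟨by omega, fun _ => by omega⟩
      · rw [runs_cons_inl h, List.length_cons]
        exact ⟨by omega, fun _ => by omega⟩
    · rw [vars_cons_inr]
      rcases runs_cons_inr_cases P a w with ⟨u, r, h1, h2⟩ | ⟨h1, h2⟩
      · rw [h2]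
        rw [h1] at ih
        exact ⟨ih.1, fun h => absurd rfl (h (none, a :: u) (by simp))⟩
      · rw [h2, List.length_cons]
        exact ⟨Nat.succ_le_succ (ih.2 h1), fun h => absurd rfl (h (none, [a]) (by simp))⟩

/-- Applied to the contents at two times, this identifies the mixed word with a pumped output.
Equality of the variable sets matters for variables that are empty under `P` and hence have no cell:
nonempty under `Q`, they would contribute a label to the second list. -/
theorem mix_runs {P Q : X → List A} {w w' : List (X ⊕ A)}
    (hlab : (runs P w).map Prod.fst = (runs Q w').map Prod.fst)
    (hvars : ∀ x, x ∈ vars w ↔ x ∈ vars w') :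
    mix (runs P w) (runs Q w') = plug Q w := by
  rw [← flatMap_runs (P := P) (Q := Q) (w := w), mix]
  · have key : ∀ r r' : List (Option X × List A), r.map Prod.fst = r'.map Prod.fst →
        (∀ x u, (some x, u) ∈ r' → u = Q x) →
        (List.zipWith (fun c c' => if c.1.isSome then c'.2 else c.2) r r').flatten =
          r.flatMap fun c => c.1.elim c.2 Q := by
      intro r
      induction r with
      | nil => intro r' _ _; rfl
      | cons c r ih =>
        rintro (_ | ⟨c', r'⟩) h1 h2
        · simp at h1
        · rw [List.map_cons, List.map_cons, List.cons.injEq] at h1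
          rw [List.zipWith_cons_cons, List.flatten_cons, List.flatMap_cons,
            ih r' h1.2 fun x u h => h2 x u (List.mem_cons_of_mem _ h)]
          congr 1
          obtain ⟨_ | x, u⟩ := c
          · rfl
          · obtain ⟨o, u'⟩ := c'
            have : o = some x := h1.1.symm
            subst this
            exact h2 x u' (by simp)
    exact key _ _ hlab fun x u h => (mem_runs_some h).2
  · intro x hx h
    by_contra hQ
    have h1 := List.mem_map_of_mem (f := Prod.fst) (some_mem_runs ((hvars x).1 hx) hQ)
    rw [← hlab, List.mem_map] at h1
    obtain ⟨⟨o, u⟩, h2, h3⟩ := h1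
    have : o = some x := h3
    subst this
    exact runs_ne_nil P w _ h2 ((mem_runs_some h2).2.trans h)

end Words

/-! ### Sequences of substitutions -/

section Sequences

variable {X A B : Type*}

theorem Subst.apply_append (σ : Subst X A) (u v : List (X ⊕ A)) :
    σ.apply (u ++ v) = σ.apply u ++ σ.apply v := List.flatMap_append

theorem Subst.apply_cons_inl (σ : Subst X A) (x : X) (w : List (X ⊕ A)) :
    σ.apply (Sum.inl x :: w) = σ.image x ++ σ.apply w := rfl

theorem Subst.apply_cons_inr (σ : Subst X A) (a : A) (w : List (X ⊕ A)) :
    σ.apply (Sum.inr a :: w) = Sum.inr a :: σ.apply w := rfl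

theorem vars_apply (σ : Subst X A) (w : List (X ⊕ A)) :
    vars (σ.apply w) = (vars w).flatMap fun x => vars (σ.image x) := by
  induction w with
  | nil => rfl
  | cons c w ih =>
    rcases c with x | a
    · rw [Subst.apply_cons_inl, vars_append, ih, vars_cons_inl, List.flatMap_cons]
    · exact ih

theorem nodup_vars_apply (σ : Subst X A) {w : List (X ⊕ A)} (h : (vars w).Nodup) :
    (vars (σ.apply w)).Nodup := by
  rw [vars_apply, List.nodup_flatMap]
  exact ⟨fun x _ => σ.nodup x, h.imp fun hxy => σ.disjoint _ _ hxy⟩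

theorem countP_letters_apply_le (σ : Subst X A) (q : A → Bool) (w : List (X ⊕ A)) :
    (letters (σ.apply w)).countP q ≤
      (letters w).countP q + ((vars w).map fun x => (σ.image x).length).sum := by
  induction w with
  | nil => simp [Subst.apply, letters]
  | cons c w ih =>
    rcases c with x | a
    · rw [Subst.apply_cons_inl, letters_append, List.countP_append, letters_cons_inl,
        vars_cons_inl, List.map_cons, List.sum_cons]
      have h1 : (letters (σ.image x)).countP q ≤ (σ.image x).length :=
        List.countP_le_length.trans (List.length_filterMap_le _ _)
      omega
    · rw [Subst.apply_cons_inr, letters_cons_inr, vars_cons_inr, List.countP_cons,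
        letters_cons_inr, List.countP_cons]
      omega

theorem mem_letters_apply {σ : Subst X A} {w : List (X ⊕ A)} {a : A}
    (h : a ∈ letters (σ.apply w)) : a ∈ letters w ∨ ∃ x, a ∈ letters (σ.image x) := by
  induction w with
  | nil => simp [Subst.apply, letters] at h
  | cons c w ih =>
    rcases c with x | b
    · rw [Subst.apply_cons_inl, letters_append, List.mem_append] at h
      rcases h with h | h
      · exact Or.inr ⟨x, h⟩
      · exact ih h
    · rw [Subst.apply_cons_inr, letters_cons_inr, List.mem_cons] at h
      rw [letters_cons_inr, List.mem_cons]
      rcases h with h | h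
      · exact Or.inl (Or.inl h)
      · exact (ih h).imp Or.inr id

/-- The output of a sequence of substitutions on a word. -/
def eval (L : List (Subst X A)) (w : List (X ⊕ A)) : List A :=
  letters (L.foldr Subst.apply w)

theorem mem_letters_foldr {L : List (Subst X A)} {w : List (X ⊕ A)} {a : A}
    (h : a ∈ letters (L.foldr Subst.apply w)) :
    a ∈ letters w ∨ ∃ σ ∈ L, ∃ x, a ∈ letters (σ.image x) := by
  induction L with
  | nil => exact Or.inl h
  | cons σ L ih =>
    rcases mem_letters_apply h with h | ⟨x, h⟩
    · exact (ih h).imp id fun ⟨τ, hτ, x, hx⟩ => ⟨τ, List.mem_cons_of_mem _ hτ, x, hx⟩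
    · exact Or.inr ⟨σ, by simp, x, h⟩

theorem foldr_apply_append (L : List (Subst X A)) (u v : List (X ⊕ A)) :
    L.foldr Subst.apply (u ++ v) = L.foldr Subst.apply u ++ L.foldr Subst.apply v := by
  induction L with
  | nil => rfl
  | cons σ L ih => rw [List.foldr_cons, ih, Subst.apply_append]; rfl

theorem foldr_apply_inr (L : List (Subst X A)) (a : A) :
    L.foldr Subst.apply [Sum.inr a] = [Sum.inr a] := by
  induction L with
  | nil => rfl
  | cons σ L ih => rw [List.foldr_cons, ih]; rfl

theorem eval_eq_plug (L : List (Subst X A)) (w : List (X ⊕ A)) :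
    eval L w = plug (fun x => eval L [Sum.inl x]) w := by
  induction w with
  | nil =>
    have : L.foldr Subst.apply [] = [] := by
      induction L with
      | nil => rfl
      | cons σ L ih => rw [List.foldr_cons, ih]; rfl
    rw [eval, this]; rfl
  | cons c w ih =>
    rw [eval, ← List.singleton_append, foldr_apply_append, letters_append]
    change _ ++ eval L w = _
    rw [ih]
    rcases c with x | a
    · rfl
    · rw [foldr_apply_inr]; rfl

/-- The word that the substitutions after time `s` produce from `O`. -/
def future (O : X) (L : List (Subst X A)) (s : ℕ) : List (X ⊕ A) :=
  (L.drop s).foldr Subst.apply [Sum.inl O]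

/-- The content of a variable at time `s`. -/
def past (L : List (Subst X A)) (s : ℕ) (x : X) : List A := eval (L.take s) [Sum.inl x]

theorem out_pump (O : X) (L : List (Subst X A)) (s t : ℕ) :
    out O (pump L s t) = plug (past L t) (future O L s) := by
  rw [out, pump, List.foldr_append]
  exact eval_eq_plug _ _

theorem out_eq_plug (O : X) (L : List (Subst X A)) (s : ℕ) :
    out O L = plug (past L s) (future O L s) := by
  rw [← out_pump, pump, List.take_append_drop]

theorem nodup_vars_future (O : X) (L : List (Subst X A)) (s : ℕ) :
    (vars (future O L s)).Nodup := by
  rw [future]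
  induction L.drop s with
  | nil => simp [vars]
  | cons σ L ih => exact nodup_vars_apply σ ih

/-- Rename the letters of a substitution. -/
def Subst.map (f : A → B) (σ : Subst X A) : Subst X B where
  image x := (σ.image x).map (Sum.map id f)
  nodup x := by rw [vars_map]; exact σ.nodup x
  disjoint x y h := by rw [vars_map, vars_map]; exact σ.disjoint x y h

theorem Subst.map_map {C : Type*} (g : B → C) (f : A → B) (σ : Subst X A) :
    (σ.map f).map g = σ.map (g ∘ f) := by
  simp only [Subst.map, List.map_map, Sum.map_comp_map, Function.comp_id]

theorem Subst.map_id (σ : Subst X A) : σ.map id = σ := by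
  simp only [Subst.map, Sum.map_id_id, List.map_id]

theorem Subst.size_map [Fintype X] (f : A → B) (σ : Subst X A) : (σ.map f).size = σ.size := by
  simp [Subst.size, Subst.map]

theorem apply_map (f : A → B) (σ : Subst X A) (w : List (X ⊕ A)) :
    (σ.map f).apply (w.map (Sum.map id f)) = (σ.apply w).map (Sum.map id f) := by
  induction w with
  | nil => rfl
  | cons c w ih =>
    rcases c with x | a
    · rw [Subst.apply_cons_inl, List.map_append, ← ih]; rfl
    · exact congrArg (Sum.inr (f a) :: ·) ih

theorem out_map (f : A → B) (O : X) (L : List (Subst X A)) :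
    out O (L.map (Subst.map f)) = (out O L).map f := by
  have : (L.map (Subst.map f)).foldr Subst.apply [Sum.inl O] =
      (L.foldr Subst.apply [Sum.inl O]).map (Sum.map id f) := by
    induction L with
    | nil => rfl
    | cons σ L ih => rw [List.map_cons, List.foldr_cons, ih, apply_map]; rfl
  rw [out, this, letters_map]
  rfl

theorem pump_map (f : Subst X A → Subst X B) (L : List (Subst X A)) (s t : ℕ) :
    pump (L.map f) s t = (pump L s t).map f := by
  simp [pump, List.map_take, List.map_drop]

/-! ### Sequences whose letters carry their origins -/

/-- Add to each letter the index of the substitution that produces it. -/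
def tag (l : List (Subst X A)) : List (Subst X (A × ℕ)) :=
  l.mapIdx fun i σ => σ.map fun a => (a, i + 1)

theorem tag_map_fst (l : List (Subst X A)) : (tag l).map (Subst.map Prod.fst) = l := by
  apply List.ext_getElem?
  intro i
  simp only [tag, List.getElem?_map, List.getElem?_mapIdx, Option.map_map]
  have : (Subst.map Prod.fst ∘ fun σ : Subst X A => σ.map fun a => (a, i + 1)) = id := by
    funext σ
    rw [Function.comp_apply, Subst.map_map]
    exact σ.map_id
  rw [this, Option.map_id]
  rfl

theorem tag_map_snd (l : List (Subst X A)) :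
    (tag l).map (Subst.map Prod.snd) = l.mapIdx fun i σ => σ.stamp (i + 1) := by
  apply List.ext_getElem?
  intro i
  simp only [tag, List.getElem?_map, List.getElem?_mapIdx, Option.map_map]
  congr 1
  funext σ
  rw [Function.comp_apply, Subst.map_map]
  rfl

theorem length_tag (l : List (Subst X A)) : (tag l).length = l.length := List.length_mapIdx

theorem out_tag_fst (O : X) (l : List (Subst X A)) : (out O (tag l)).map Prod.fst = out O l := by
  rw [← out_map, tag_map_fst]

theorem out_pump_tag_fst (O : X) (l : List (Subst X A)) (s t : ℕ) :
    (out O (pump (tag l) s t)).map Prod.fst = out O (pump l s t) := by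
  rw [← out_map, ← pump_map, tag_map_fst]

theorem weight_eq (O : X) (j t : ℕ) (l : List (Subst X A)) :
    weight O j t l = ((out O (tag l)).take j).countP fun c => decide (c.2 ≤ t) := by
  rw [weight, originWord, ← tag_map_snd, out_map, ← List.map_take, List.countP_map]
  rfl

theorem snd_of_mem_tag {l : List (Subst X A)} {i : ℕ} {σ : Subst X (A × ℕ)}
    (h : (tag l)[i]? = some σ) {x : X} {c : A × ℕ} (hc : c ∈ letters (σ.image x)) :
    c.2 = i + 1 := by
  rw [tag, List.getElem?_mapIdx, Option.map_eq_some_iff] at h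
  obtain ⟨τ, -, rfl⟩ := h
  simp only [Subst.map, letters_map, List.mem_map] at hc
  obtain ⟨a, -, rfl⟩ := hc
  rfl

theorem snd_le_of_mem_past {l : List (Subst X A)} {s : ℕ} {x : X} {c : A × ℕ}
    (h : c ∈ past (tag l) s x) : c.2 ≤ s := by
  rcases mem_letters_foldr h with h | ⟨σ, hσ, y, hy⟩
  · simp [letters] at h
  · obtain ⟨i, hi⟩ := List.mem_iff_getElem?.1 hσ
    rw [List.getElem?_take] at hi
    split_ifs at hi with his
    rw [snd_of_mem_tag hi hy]
    exact his

theorem lt_snd_of_mem_future {O : X} {l : List (Subst X A)} {s : ℕ} {c : A × ℕ}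
    (h : c ∈ letters (future O (tag l) s)) : s < c.2 := by
  rcases mem_letters_foldr h with h | ⟨σ, hσ, y, hy⟩
  · simp [letters] at h
  · obtain ⟨i, hi⟩ := List.mem_iff_getElem?.1 hσ
    rw [List.getElem?_drop] at hi
    rw [snd_of_mem_tag hi hy]
    omega

theorem sum_map_le_sum_univ [Fintype X] {v : List X} (h : v.Nodup) (f : X → ℕ) :
    (v.map f).sum ≤ ∑ x, f x := by
  classical
  rw [← List.sum_toFinset f h]
  exact Finset.sum_le_sum_of_subset (Finset.subset_univ _)

/-- The new letters have origin `s + 1`, so they come from one substitution applied to the later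
future. By copylessness each variable occurs there at most once, so each image is used at most once.
-/
theorem weight_succ_le [Fintype X] (O : X) (j s : ℕ) {l : List (Subst X A)} (hs : s < l.length) :
    weight O j (s + 1) l ≤ weight O j s l + l[s].size := by
  rw [weight_eq, weight_eq]
  have hsplit : ∀ v : List (A × ℕ), v.countP (fun c => decide (c.2 ≤ s + 1)) ≤
      v.countP (fun c => decide (c.2 ≤ s)) + v.countP (fun c => decide (c.2 = s + 1)) := by
    intro v
    induction v with
    | nil => simp
    | cons c v ih =>
      simp only [List.countP_cons, decide_eq_true_eq]
      split_ifs <;> omega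
  refine (hsplit _).trans (Nat.add_le_add_left ?_ _)
  refine ((List.take_sublist _ _).countP_le).trans ?_
  have hs' : s < (tag l).length := by rwa [length_tag]
  have hfut : future O (tag l) s = ((tag l)[s]).apply (future O (tag l) (s + 1)) := by
    rw [future, List.drop_eq_getElem_cons hs']; rfl
  have hsize : ((tag l)[s]).size = l[s].size := by
    simp only [tag, List.getElem_mapIdx, Subst.size_map]
  rw [out_eq_plug O (tag l) s, countP_plug]
  have h0 : ((vars (future O (tag l) s)).map fun x =>
      (past (tag l) s x).countP fun c => decide (c.2 = s + 1)).sum = 0 := by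
    rw [List.sum_eq_zero_iff]
    intro n hn
    obtain ⟨x, -, rfl⟩ := List.mem_map.1 hn
    rw [List.countP_eq_zero]
    intro c hc
    have := snd_le_of_mem_past hc
    simp only [decide_eq_true_eq]
    omega
  have h1 : (letters (future O (tag l) (s + 1))).countP (fun c => decide (c.2 = s + 1)) = 0 := by
    rw [List.countP_eq_zero]
    intro c hc
    have := lt_snd_of_mem_future hc
    simp only [decide_eq_true_eq]
    omega
  rw [h0, hfut, Nat.add_zero]
  refine (countP_letters_apply_le _ _ _).trans ?_
  rw [h1, Nat.zero_add, ← hsize]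
  exact sum_map_le_sum_univ (nodup_vars_future O _ _) _

/-! ### The type of a time -/

/-- The types of times: labels of cells, sets of variables, and indices of cells. -/
abbrev TimeType (X : Type*) [Fintype X] :=
  (Fin (2 * Fintype.card X + 1) → Option (Option X)) × Finset X × Fin (2 * Fintype.card X + 2)

open Classical in
/-- The type of the time `s`: the labels of the cells of the output at time `s`, the variables that
are still used, and the index of the cell that contains position `a`. -/
noncomputable def timeType [Fintype X] (O : X) (L : List (Subst X A)) (a s : ℕ) : TimeType X :=
  (fun i => ((runs (past L s) (future O L s)).map Prod.fst)[(i : ℕ)]?,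
    (vars (future O L s)).toFinset,
    ⟨min (cellIdx (runs (past L s) (future O L s)) a) (2 * Fintype.card X + 1), by omega⟩)

theorem length_runs_past_future [Fintype X] (O : X) (L : List (Subst X A)) (s : ℕ) :
    (runs (past L s) (future O L s)).length ≤ 2 * Fintype.card X + 1 := by
  have h1 := (length_runs_le (past L s) (future O L s)).1
  have h2 := (nodup_vars_future O L s).length_le_card
  omega

theorem labels_eq_of_timeType_eq [Fintype X] {O : X} {L : List (Subst X A)} {a s t : ℕ}
    (h : timeType O L a s = timeType O L a t) :
    (runs (past L s) (future O L s)).map Prod.fst =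
      (runs (past L t) (future O L t)).map Prod.fst := by
  apply List.ext_getElem?
  intro i
  by_cases hi : i < 2 * Fintype.card X + 1
  · exact congrFun (congrArg Prod.fst h) ⟨i, hi⟩
  · have h1 := length_runs_past_future O L s
    have h2 := length_runs_past_future O L t
    rw [List.getElem?_eq_none (by rw [List.length_map]; omega),
      List.getElem?_eq_none (by rw [List.length_map]; omega)]

theorem mem_vars_iff_of_timeType_eq [Fintype X] {O : X} {L : List (Subst X A)} {a s t : ℕ}
    (h : timeType O L a s = timeType O L a t) (x : X) :
    x ∈ vars (future O L s) ↔ x ∈ vars (future O L t) := by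
  have := congrArg (fun p : TimeType X => x ∈ p.2.1) h
  simpa [timeType] using this

theorem cellIdx_eq_of_timeType_eq [Fintype X] {O : X} {L : List (Subst X A)} {a s t : ℕ}
    (h : timeType O L a s = timeType O L a t) :
    cellIdx (runs (past L s) (future O L s)) a = cellIdx (runs (past L t) (future O L t)) a := by
  have := congrArg (fun p : TimeType X => (p.2.2 : ℕ)) h
  simp only [timeType] at this
  -- The minimum in `timeType` loses nothing, as a cell index never exceeds the number of cells.
  have h1 := (cellIdx_le (runs (past L s) (future O L s)) a).trans (length_runs_past_future O L s)
  have h2 := (cellIdx_le (runs (past L t) (future O L t)) a).trans (length_runs_past_future O L t)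
  omega

/-- Contents of variables at time `s` have origin at most `s`, and letters of the future have later
origins. So being in a labelled cell is a property of the letter's origin alone. -/
theorem marked_runs_tag (O : X) (l : List (Subst X A)) (s : ℕ) :
    marked (runs (past (tag l) s) (future O (tag l) s)) =
      (out O (tag l)).map fun c => (decide (c.2 ≤ s), c) := by
  rw [out_eq_plug O (tag l) s, ← flat_runs, flat, List.map_flatMap, marked]
  apply List.flatMap_congr
  rintro ⟨_ | x, u⟩ hc
  · apply List.map_congr_left
    intro c hcu
    have := lt_snd_of_mem_future (mem_letters_of_mem_runs hc c hcu)
    simp [this]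
  · obtain rfl := (mem_runs_some hc).2
    apply List.map_congr_left
    intro c hcu
    have := snd_le_of_mem_past hcu
    simp [this]

/-- Pumping between two times of the same type preserves each region of the output to which nothing
is added between these times, and shifts it according to the weights. -/
theorem exists_drop_out_pump [Fintype X] {O : X} {l : List (Subst X A)} {a s t n : ℕ}
    (h : timeType O (tag l) a s = timeType O (tag l) a t) (hn : 0 < n)
    (han : a + n ≤ (out O l).length)
    (hR : ∀ c ∈ ((out O (tag l)).drop a).take n, c.2 ≤ s ↔ c.2 ≤ t) :
    ∃ z, ((out O (pump l s t)).drop z).take n = ((out O l).drop a).take n ∧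
      z + weight O a s l = a + weight O a t l := by
  have hlen : (out O (tag l)).length = (out O l).length := by
    rw [← out_tag_fst O l, List.length_map]
  have hlab := labels_eq_of_timeType_eq h
  have hfl : ∀ s, flat (runs (past (tag l) s) (future O (tag l) s)) = out O (tag l) := fun s => by
    rw [flat_runs, ← out_eq_plug]
  have hcnt : ∀ s, ((marked (runs (past (tag l) s) (future O (tag l) s))).take a).countP
      Prod.fst = weight O a s l := fun s => by
    rw [marked_runs_tag, ← List.map_take, List.countP_map, weight_eq]
    rfl
  have hforall : List.Forall₂ (fun c c' : Option X × List (A × ℕ) => c.1 = c'.1)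
      (runs (past (tag l) s) (future O (tag l) s)) (runs (past (tag l) t) (future O (tag l) t)) := by
    have h1 := List.forall₂_eq_eq_eq (α := Option X) ▸ hlab
    rwa [List.forall₂_map_left_iff, List.forall₂_map_right_iff] at h1
  obtain ⟨z, hz1, hz2⟩ := exists_mix_drop hforall (runs_ne_nil _ _) (runs_ne_nil _ _)
    (runs_isChain _ _) a a n hn (cellIdx_eq_of_timeType_eq h) (by rw [hfl, hlen]; exact han)
    (by rw [hfl, hlen]; exact han) (by
      rw [marked_runs_tag, marked_runs_tag, ← List.map_drop, ← List.map_drop, ← List.map_take,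
        ← List.map_take]
      apply List.map_congr_left
      intro c hc
      simp only [hR c hc])
  rw [hcnt, hcnt] at hz2
  refine ⟨z, ?_, hz2⟩
  rw [mix_runs hlab (mem_vars_iff_of_timeType_eq h), ← out_pump, hfl] at hz1
  have := congrArg (List.map Prod.fst) hz1
  simpa only [List.map_take, List.map_drop, out_tag_fst, out_pump_tag_fst] using this

/-- The length of the output after pumping between two times of the same type. -/
theorem length_out_pump [Fintype X] {O : X} {l : List (Subst X A)} {a s t : ℕ}
    (h : timeType O (tag l) a s = timeType O (tag l) a t) :
    (out O (pump l s t)).length + weight O (out O l).length s l =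
      (out O l).length + weight O (out O l).length t l := by
  have hlen : (out O (tag l)).length = (out O l).length := by
    rw [← out_tag_fst O l, List.length_map]
  have hw : ∀ s, weight O (out O l).length s l =
      ((vars (future O (tag l) s)).map fun x => (past (tag l) s x).length).sum := by
    intro s
    rw [weight_eq, ← hlen, List.take_length, out_eq_plug O (tag l) s, countP_plug,
      List.countP_eq_zero.2, Nat.zero_add]
    · congr 1
      apply List.map_congr_left
      intro x _
      rw [List.countP_eq_length]
      intro c hc
      simpa using snd_le_of_mem_past hc
    · intro c hc
      simpa using lt_snd_of_mem_future hc
  have hperm : (vars (future O (tag l) s)).Perm (vars (future O (tag l) t)) :=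
    (List.perm_ext_iff_of_nodup (nodup_vars_future _ _ _) (nodup_vars_future _ _ _)).2
      (mem_vars_iff_of_timeType_eq h)
  have h1 : (out O (pump l s t)).length = (letters (future O (tag l) s)).length +
      ((vars (future O (tag l) t)).map fun x => (past (tag l) t x).length).sum := by
    rw [← out_pump_tag_fst, List.length_map, out_pump, length_plug, (hperm.map _).sum_eq]
  have h2 := length_plug (past (tag l) s) (future O (tag l) s)
  rw [← out_eq_plug, hlen] at h2
  rw [hw, hw, h1, h2]
  omega

end Sequences

end SST

namespace SST

/-! ### ### Properties of weights, and periods from two occurrences -/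

section Weights

variable {X A : Type*}

theorem weight_mono (O : X) (j : ℕ) (l : List (Subst X A)) : Monotone fun t => weight O j t l := by
  intro s t hst
  refine List.countP_mono_left fun c _ hc => ?_
  simp only [decide_eq_true_eq] at hc ⊢
  omega

theorem weight_le (O : X) (j t : ℕ) (l : List (Subst X A)) : weight O j t l ≤ j :=
  List.countP_le_length.trans (List.length_take_le _ _)

theorem weight_add (O : X) (j n t : ℕ) (l : List (Subst X A)) :
    weight O (j + n) t l = weight O j t l +
      (((out O (tag l)).drop j).take n).countP fun c => decide (c.2 ≤ t) := by
  rw [weight_eq, weight_eq, List.take_add, List.countP_append]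

theorem weight_le_weight_add (O : X) (j n t : ℕ) (l : List (Subst X A)) :
    weight O j t l ≤ weight O (j + n) t l ∧ weight O (j + n) t l ≤ weight O j t l + n := by
  rw [weight_add]
  exact ⟨Nat.le_add_right _ _, Nat.add_le_add_left
    (List.countP_le_length.trans (List.length_take_le _ _)) _⟩

theorem weight_zero (O : X) (j : ℕ) (l : List (Subst X A)) : weight O j 0 l = 0 := by
  rw [weight_eq, List.countP_eq_zero]
  intro c hc
  have h1 : c ∈ letters (future O (tag l) 0) := List.mem_of_mem_take hc
  simpa using (lt_snd_of_mem_future h1).ne'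

theorem weight_length (O : X) (j : ℕ) (l : List (Subst X A)) :
    weight O j l.length l = min j (out O l).length := by
  rw [weight_eq, List.countP_eq_length.2, List.length_take, ← out_tag_fst O l, List.length_map]
  intro c hc
  have h1 : c ∈ past (tag l) (tag l).length O := by
    rw [past, eval, List.take_length]
    exact List.mem_of_mem_take hc
  have h2 := snd_le_of_mem_past h1
  rw [length_tag] at h2
  simpa using h2

/-- Turns a constant count of letters produced in the window into the statement that none of its
letters has its origin between the two times. -/
theorem forall_iff_of_countP_eq {B : Type*} {p q : B → Bool} : ∀ {v : List B},
    (∀ c, p c → q c) → v.countP p = v.countP q → ∀ c ∈ v, p c ↔ q c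
  | [], _, _, c, hc => by simp at hc
  | b :: v, hpq, h, c, hc => by
    have h1 : v.countP p ≤ v.countP q := List.countP_mono_left fun c _ => hpq c
    rw [List.countP_cons, List.countP_cons] at h
    have h2 := hpq b
    have h3 : (p b ↔ q b) ∧ v.countP p = v.countP q := by
      by_cases hp : p b = true
      · have hq := h2 hp
        rw [if_pos hp, if_pos hq] at h
        exact ⟨by simp [hp, hq], by omega⟩
      · by_cases hq : q b = true
        · rw [if_neg hp, if_pos hq] at h
          omega
        · rw [if_neg hp, if_neg hq] at h
          exact ⟨by simp [hp, hq], by omega⟩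
    rcases List.mem_cons.1 hc with rfl | hc
    · exact h3.1
    · exact forall_iff_of_countP_eq hpq h3.2 c hc

/-- If a region of a word `y` occurs in a word at two places at distance `d`, then it has period
`d`. -/
theorem period_of_two_occurrences {B : Type*} {y w : List B} {a n z d : ℕ}
    (h1 : (w.drop (z + d)).take n = (y.drop a).take n) (h2 : (w.drop z).take n = (y.drop a).take n)
    (i : ℕ) (hi : a ≤ i) (hin : i + d < a + n) : y[i + d]? = y[i]? := by
  obtain ⟨i, rfl⟩ := Nat.exists_eq_add_of_le hi
  have e1 := congrArg (fun u : List B => u[i]?) h1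
  have e2 := congrArg (fun u : List B => u[i + d]?) h2
  simp only [List.getElem?_take_of_lt (show i < n by omega), List.getElem?_drop] at e1
  simp only [List.getElem?_take_of_lt (show i + d < n by omega), List.getElem?_drop] at e2
  rw [← e1, Nat.add_assoc, ← e2]
  congr 1
  omega

end Weights

/-! ### ### Pumping times from a large weight difference -/

section Main

variable {X A : Type*} [Fintype X]

/-- The number of pairs of types of times. -/
noncomputable def pairCount (X : Type*) [Fintype X] : ℕ :=
  Fintype.card (TimeType X × TimeType X)

theorem weight_succ_sub_le {O : X} {M : ℕ} {lam mu : List (Subst X A)}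
    (hM : ∀ σ ∈ lam, σ.size ≤ M) (a s : ℕ) (hs : s < lam.length) :
    (weight O a (s + 1) lam : ℤ) - weight O a (s + 1) mu ≤
      (weight O a s lam : ℤ) - weight O a s mu + M := by
  have h1 := weight_succ_le O a s hs
  have h2 := hM lam[s] (List.getElem_mem hs)
  have h3 : weight O a s mu ≤ weight O a (s + 1) mu := weight_mono O a mu (Nat.le_succ s)
  omega

/-- Times at which the outputs after pumping differ, for a cut that is far from the end. -/
theorem exists_times_of_interior_cut {O : X} {M C b j T : ℕ} {lam mu : List (Subst X A)}
    (hM : ∀ σ ∈ lam, σ.size ≤ M) (hout : out O lam = out O mu) (hT : T ≤ lam.length)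
    (hb : b = C * pairCount X * (M + 1)) (hb0 : 0 < b) (hj : j ∈ cuts b (out O lam))
    (hjb : j + b ≤ (out O lam).length)
    (hw : weight O j T mu + 9 * b ^ 2 < weight O j T lam) :
    ∃ t : Fin C → ℕ, StrictMono t ∧ (∀ i, t i ≤ T) ∧ ∀ i j : Fin C, i < j →
      out O (pump lam (t i) (t j)) ≠ out O (pump mu (t i) (t j)) := by
  have hbb : b ≤ b ^ 2 := Nat.le_self_pow two_ne_zero b
  have hj0 := weight_le O j T lam
  -- The weight bounds `j` from below, so `j > 9 * b ^ 2 ≥ 2 * b` and the subtraction is exact. The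
  -- window has length `3 * b`: `2 * b` before the cut and `b` after it.
  obtain ⟨a, rfl⟩ : ∃ a, j = a + 2 * b := ⟨j - 2 * b, by omega⟩
  let R : List (Subst X A) → List (A × ℕ) := fun l => ((out O (tag l)).drop a).take (3 * b)
  let cnt : List (Subst X A) → ℕ → ℕ := fun l s => (R l).countP fun c => decide (c.2 ≤ s)
  have hcmono : ∀ l, Monotone (cnt l) := fun l s t hst =>
    List.countP_mono_left fun c _ hc => by
      simp only [decide_eq_true_eq] at hc ⊢
      omega
  have hcle : ∀ l s, cnt l s ≤ 3 * b := fun l s =>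
    List.countP_le_length.trans (List.length_take_le _ _)
  have hl := weight_le_weight_add O a (2 * b) T lam
  have hm := weight_le_weight_add O a (2 * b) T mu
  obtain ⟨t, ht1, ht2, ht3⟩ := exists_times
    (fun s => (weight O a s lam : ℤ) - weight O a s mu) T M (6 * b) C
    (fun s => (timeType O (tag lam) a s, timeType O (tag mu) a s))
    (fun s => cnt lam s + cnt mu s) (by simp [weight_zero])
    (fun s hs => weight_succ_sub_le hM a s (by omega))
    (fun s t hst => Nat.add_le_add (hcmono lam hst) (hcmono mu hst))
    (fun s => by
      have := hcle lam s
      have := hcle mu s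
      omega)
    (by
      -- The bound `6 * b` counts both windows. Moving from `j` to `a` costs at most `2 * b`, and `9
      -- * b ^ 2 - 2 * b ≥ 6 * b ^ 2 + b` explains the factor 9.
      have e : (6 * b + 1) * (C * Fintype.card (TimeType X × TimeType X)) * (M + 1) =
          6 * b ^ 2 + b := by
        rw [Nat.mul_assoc]
        change (6 * b + 1) * (C * pairCount X * (M + 1)) = _
        rw [← hb]; ring
      rw [e]
      omega)
  refine ⟨t, ht1, ht2, fun i j hij heq => ?_⟩
  obtain ⟨h1, h2, h3, h4⟩ := ht3 i j hij
  have hle : t i ≤ t j := (ht1 hij).le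
  change _ ≤ (((C * pairCount X * (M + 1) : ℕ) : ℤ)) at h2
  rw [← hb] at h2
  simp only [Prod.mk.injEq] at h3
  have hc1 := hcmono lam hle
  have hc2 := hcmono mu hle
  have hiff : ∀ l, cnt l (t i) = cnt l (t j) → ∀ c ∈ R l, c.2 ≤ t i ↔ c.2 ≤ t j :=
    fun l hl c hc => by
      have := forall_iff_of_countP_eq (fun c hc => by
        simp only [decide_eq_true_eq] at hc ⊢
        omega) hl c hc
      simpa using this
  obtain ⟨z, hz1, hz2⟩ := exists_drop_out_pump h3.1 (n := 3 * b) (by omega) (by omega)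
    (hiff lam (by omega))
  obtain ⟨z', hz1', hz2'⟩ := exists_drop_out_pump h3.2 (n := 3 * b) (by omega)
    (by rw [← hout]; omega) (hiff mu (by omega))
  -- The two shifts differ by exactly the increase of the weight difference between `t i` and `t j`,
  -- which lies between 1 and `b`.
  obtain ⟨d, rfl⟩ : ∃ d, z = z' + d := ⟨z - z', by omega⟩
  rw [← heq, ← hout] at hz1'
  exact not_mem_cuts_of_period (d := d) (by omega) (by omega) hjb
    (fun p hp1 hp2 => period_of_two_occurrences hz1 hz1' p (by omega) (by omega)) hj

/-- Times at which the outputs after pumping differ, for a position close to the end. -/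
theorem exists_times_of_near_end {O : X} {M C b j T : ℕ} {lam mu : List (Subst X A)}
    (hM : ∀ σ ∈ lam, σ.size ≤ M) (hout : out O lam = out O mu) (hT : T ≤ lam.length)
    (hb : b = C * pairCount X * (M + 1)) (hjb : (out O lam).length ≤ j + b)
    (hw : weight O j T mu + 2 * b < weight O j T lam) :
    ∃ t : Fin C → ℕ, StrictMono t ∧ (∀ i, t i ≤ T) ∧ ∀ i j : Fin C, i < j →
      out O (pump lam (t i) (t j)) ≠ out O (pump mu (t i) (t j)) := by
  set a := (out O lam).length with ha
  -- Passing from `j` to the end of the output costs at most `b`; if `j` is beyond the end, the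
  -- weights do not change.
  have hwa : weight O a T mu + b < weight O a T lam := by
    rcases le_total j a with h | h
    · obtain ⟨n, hn⟩ := Nat.exists_eq_add_of_le h
      have hl := weight_le_weight_add O j n T lam
      have hm := weight_le_weight_add O j n T mu
      rw [← hn] at hl hm
      omega
    · have h1 : ∀ l : List (Subst X A), (out O l).length = a →
          weight O j T l = weight O a T l := fun l hl => by
        have : (out O (tag l)).length = a := by rw [← hl, ← out_tag_fst O l, List.length_map]
        rw [weight_eq, weight_eq, List.take_of_length_le (by omega),
          List.take_of_length_le (by omega)]
      rw [h1 lam rfl, h1 mu (by rw [← hout])] at hw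
      omega
  obtain ⟨t, ht1, ht2, ht3⟩ := exists_times
    (fun s => (weight O a s lam : ℤ) - weight O a s mu) T M 0 C
    (fun s => (timeType O (tag lam) a s, timeType O (tag mu) a s))
    (fun _ => 0) (by simp [weight_zero])
    (fun s hs => weight_succ_sub_le hM a s (by omega))
    (fun _ _ _ => le_rfl) (fun _ => le_rfl)
    (by
      have e : (0 + 1) * (C * Fintype.card (TimeType X × TimeType X)) * (M + 1) = b := by
        rw [Nat.zero_add, Nat.one_mul, hb]; rfl
      rw [e]
      omega)
  refine ⟨t, ht1, ht2, fun i j hij heq => ?_⟩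
  obtain ⟨h1, -, h3, -⟩ := ht3 i j hij
  simp only [Prod.mk.injEq] at h3
  have e1 := length_out_pump h3.1
  have e2 := length_out_pump h3.2
  rw [← heq, ← hout] at e2
  rw [← ha] at e1 e2
  omega

theorem exists_times_of_cut {O : X} {M C b j T : ℕ} {lam mu : List (Subst X A)}
    (hM : ∀ σ ∈ lam, σ.size ≤ M) (hlen : lam.length = mu.length) (hout : out O lam = out O mu)
    (hT : T ≤ lam.length) (hb : b = C * pairCount X * (M + 1)) (hb0 : 0 < b)
    (hj : j ∈ cuts b (out O lam)) (hw : weight O j T mu + 9 * b ^ 2 < weight O j T lam) :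
    ∃ t : Fin C → ℕ, StrictMono t ∧ (∀ i, t i < lam.length) ∧ ∀ i j : Fin C, i < j →
      out O (pump lam (t i) (t j)) ≠ out O (pump mu (t i) (t j)) := by
  have hbb : b ≤ b ^ 2 := Nat.le_self_pow two_ne_zero b
  -- At the final time both weights are `min j |out|`, so a positive difference occurs strictly
  -- earlier. This gives the strict bound on the chosen times.
  have hT' : T < lam.length := by
    rcases hT.lt_or_eq with h | h
    · exact h
    · rw [h, weight_length, hlen, weight_length, hout] at hw
      omega
  obtain ⟨t, h1, h2, h3⟩ : ∃ t : Fin C → ℕ, StrictMono t ∧ (∀ i, t i ≤ T) ∧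
      ∀ i j : Fin C, i < j → out O (pump lam (t i) (t j)) ≠ out O (pump mu (t i) (t j)) := by
    rcases le_total (j + b) (out O lam).length with h | h
    · exact exists_times_of_interior_cut hM hout hT hb hb0 hj h hw
    · exact exists_times_of_near_end hM hout hT hb h (by omega)
  exact ⟨t, h1, fun i => (h2 i).trans_lt hT', h3⟩

/-! ### ### The size of the constants and the theorem -/

theorem pairCount_pos (O : X) : 0 < pairCount X :=
  Fintype.card_pos_iff.2 ⟨(timeType O ([] : List (Subst X Unit)) 0 0,
    timeType O ([] : List (Subst X Unit)) 0 0)⟩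

theorem pairCount_le [Nonempty X] :
    pairCount X ≤ (Fintype.card X + 1) ^ (10 * (Fintype.card X + 1)) := by
  set r := Fintype.card X with hr
  have hr0 : 0 < r := Fintype.card_pos
  have h1 : Fintype.card (TimeType X) ≤ (r + 1) ^ (5 * (r + 1)) := by
    simp only [TimeType, Fintype.card_prod, Fintype.card_fun, Fintype.card_option, Fintype.card_fin,
      Fintype.card_finset, ← hr]
    calc (r + 1 + 1) ^ (2 * r + 1) * (2 ^ r * (2 * r + 2))
        ≤ ((r + 1) ^ 2) ^ (2 * r + 1) * ((r + 1) ^ r * (r + 1) ^ 2) := by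
          gcongr
          · nlinarith
          · omega
          · nlinarith
      _ = (r + 1) ^ (5 * r + 4) := by
          rw [← pow_mul, ← pow_add, ← pow_add]
          congr 1
          ring
      _ ≤ (r + 1) ^ (5 * (r + 1)) := Nat.pow_le_pow_right (by omega) (by omega)
  rw [pairCount, Fintype.card_prod]
  calc _ ≤ (r + 1) ^ (5 * (r + 1)) * (r + 1) ^ (5 * (r + 1)) := Nat.mul_le_mul h1 h1
    _ = (r + 1) ^ (10 * (r + 1)) := by
      rw [← pow_add]
      congr 1
      ring

end Main

end SST

theorem mainTheorem5 :
    ∃ c : ℕ, ∀ (X A : Type*) [Fintype X] [Finite A] (O : X) (S : Finset (SST.Subst X A)),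
      ∃ k l : ℕ, 0 < l ∧
        k ≤ (S.sup SST.Subst.size + 1) ^ c * (Fintype.card X + 1) ^ (c * (Fintype.card X + 1)) ∧
        l ≤ (S.sup SST.Subst.size + 1) ^ c * (Fintype.card X + 1) ^ (c * (Fintype.card X + 1)) ∧
        ∀ (C : ℕ) (lam mu : List (SST.Subst X A)),
          (∀ σ ∈ lam, σ ∈ S) → (∀ σ ∈ mu, σ ∈ S) →
          lam.length = mu.length →
          SST.out O lam = SST.out O mu →
          C ^ 2 * k < SST.delay O (C * l) lam mu →
          ∃ t : Fin C → ℕ, StrictMono t ∧ (∀ i, t i < lam.length) ∧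
            ∀ i j : Fin C, i < j →
              SST.out O (SST.pump lam (t i) (t j)) ≠ SST.out O (SST.pump mu (t i) (t j)) := by
  -- With `q = card X + 1 ≥ 2`, the factor 9 is at most `q ^ 4`, and squaring the bound on `K` gives
  -- `q ^ (20 * q)`; finally `4 + 20 * q ≤ 24 * q`.
  refine ⟨24, fun X A _ _ O S => ?_⟩
  set M := S.sup SST.Subst.size with hMdef
  set q := Fintype.card X + 1 with hq
  have : Nonempty X := ⟨O⟩
  have hq2 : 2 ≤ q := Nat.succ_le_succ Fintype.card_pos
  have hK := SST.pairCount_le (X := X)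
  rw [← hq] at hK
  set K := SST.pairCount X with hKdef
  have hK0 : 0 < K := SST.pairCount_pos O
  have hl0 : 0 < K * (M + 1) := Nat.mul_pos hK0 (Nat.succ_pos M)
  have hk : 9 * (K * (M + 1)) ^ 2 ≤ (M + 1) ^ 24 * q ^ (24 * q) := by
    calc 9 * (K * (M + 1)) ^ 2 ≤ 2 ^ 4 * (q ^ (10 * q) * (M + 1)) ^ 2 := by gcongr; norm_num
      _ ≤ q ^ 4 * (q ^ (10 * q) * (M + 1)) ^ 2 := by gcongr
      _ = (M + 1) ^ 2 * q ^ (4 + 10 * q * 2) := by rw [mul_pow, ← pow_mul, pow_add]; ring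
      _ ≤ (M + 1) ^ 24 * q ^ (24 * q) := by
        apply Nat.mul_le_mul
        · exact Nat.pow_le_pow_right (Nat.succ_pos M) (by norm_num)
        · exact Nat.pow_le_pow_right (by omega) (by omega)
  refine ⟨9 * (K * (M + 1)) ^ 2, K * (M + 1), hl0, hk, le_trans ?_ hk, ?_⟩
  · exact (Nat.le_self_pow two_ne_zero _).trans (Nat.le_mul_of_pos_left _ (by norm_num))
  intro C lam mu hlam hmu hlen hout hdelay
  rcases Nat.eq_zero_or_pos C with rfl | hC
  · exact ⟨fun i => i.elim0, fun i => i.elim0, fun i => i.elim0, fun i => i.elim0⟩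
  have hb0 : 0 < C * (K * (M + 1)) := Nat.mul_pos hC hl0
  set b := C * (K * (M + 1)) with hb
  have hb' : b = C * SST.pairCount X * (M + 1) := (Nat.mul_assoc _ _ _).symm
  have hCk : C ^ 2 * (9 * (K * (M + 1)) ^ 2) = 9 * b ^ 2 := by rw [hb]; ring
  rw [hCk, SST.delay, Finset.lt_sup_iff] at hdelay
  obtain ⟨j, hj, hdelay⟩ := hdelay
  rw [SST.maxDiff, Finset.lt_sup_iff] at hdelay
  obtain ⟨T, hT, hdelay⟩ := hdelay
  rw [Finset.mem_Icc] at hT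
  rw [SST.diff] at hdelay
  have hsize : ∀ σ ∈ S, σ.size ≤ M := fun σ hσ => Finset.le_sup (f := SST.Subst.size) hσ
  by_cases hlt : SST.weight O j T mu < SST.weight O j T lam
  · exact SST.exists_times_of_cut (fun σ hσ => hsize σ (hlam σ hσ)) hlen hout hT.2 hb' hb0 hj
      (by omega)
  -- The delay is symmetric, so if μ is ahead the two sequences exchange roles.
  · obtain ⟨t, h1, h2, h3⟩ := SST.exists_times_of_cut (fun σ hσ => hsize σ (hmu σ hσ)) hlen.symm
      hout.symm (hlen ▸ hT.2) hb' hb0 (hout ▸ hj) (by omega)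
    exact ⟨t, h1, fun i => by rw [hlen]; exact h2 i, fun i j hij => (h3 i j hij).symm⟩
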